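/- For each $n$ let $a_{i,j}, b_{i,k}, c_{j,k}$ ($1\le i,j,k\le n$) be $3n^2$ independent random variables, each uniform on $[0,1]$, and let $W_{i,j,k}=a_{i,j}+b_{i,k}+c_{j,k}$. Consider the greedy algorithm: start with $B=C=[n]$; in round $i=1,2,\dots,n$ choose $(j,k)\in B\times C$ that minimizes $W_{i,j',k'}$ over $(j',k')\in B\times C$ (ties, which have probability $0$, are broken by an arbitrary rule that depends only on the set of minimizers), add the triple $(i,j,k)$, and remove $j$ from $B$ and $k$ from $C$. Let $W_m$ be the weight of the triple added in round $m$, and let $c_1=6^{1/3}\,\Gamma(4/3)$, where $\Gamma$ is Euler's Gamma function. Then, uniformly over $1\le m\le n-n^{1/4}$, as $n\to\infty$, $$\mathbf{E}(W_m)\le (1+o(1))\,c_1\,(n-m+1)^{-2/3}.$$ That is, for every $\varepsilon>0$ there is $N$ such that for all $n\ge N$ and all integers $m$ with $1\le m\le n-n^{1/4}$, we have $\mathbf{E}(W_m)\le(1+\varepsilon)\,c_1\,(n-m+1)^{-2/3}$. -/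

import Mathlib

open MeasureTheory ProbabilityTheory

noncomputable section

/-- The decomposable cost `W_{i,j,k} = a_{i,j} + b_{i,k} + c_{j,k}`. -/
def planarCost {n : ℕ} (a b c : Fin n → Fin n → ℝ) (i j k : Fin n) : ℝ :=
  a i j + b i k + c j k

open Classical in
/-- The pairs `(j, k) ∈ B × C` at which `w` attains its minimum over `B × C`. -/
def minimizers {n : ℕ} (w : Fin n → Fin n → ℝ) (B C : Finset (Fin n)) :
    Finset (Fin n × Fin n) :=
  (B ×ˢ C).filter fun p => ∀ q ∈ B ×ˢ C, w p.1 p.2 ≤ w q.1 q.2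

/-- A tie-breaking rule: it selects an element of every nonempty set of minimizers. -/
def IsTieBreak {n : ℕ} (pick : Finset (Fin n × Fin n) → Fin n × Fin n) : Prop :=
  ∀ S : Finset (Fin n × Fin n), S.Nonempty → pick S ∈ S

/-- The pair of sets `(B, C)` of the greedy algorithm after `r` rounds. Initially `B = C = [n]`;
the round that treats the first index `r` chooses a minimizer `(j, k)` of `W r` over `B × C`,
and removes `j` from `B` and `k` from `C`. -/
def greedySets {n : ℕ} (W : Fin n → Fin n → Fin n → ℝ)
    (pick : Finset (Fin n × Fin n) → Fin n × Fin n) : ℕ → Finset (Fin n) × Finset (Fin n)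
  | 0 => (Finset.univ, Finset.univ)
  | r + 1 =>
    if h : r < n then
      ((greedySets W pick r).1.erase
          (pick (minimizers (W ⟨r, h⟩) (greedySets W pick r).1 (greedySets W pick r).2)).1,
        (greedySets W pick r).2.erase
          (pick (minimizers (W ⟨r, h⟩) (greedySets W pick r).1 (greedySets W pick r).2)).2)
    else greedySets W pick r

/-- The pair `(j, k)` such that greedy adds the triple `(i, j, k)`. The indices `i : Fin n` are
treated in increasing order, so that this happens in round `i + 1` (rounds counted from `1`). -/
def greedyPair {n : ℕ} (W : Fin n → Fin n → Fin n → ℝ)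
    (pick : Finset (Fin n × Fin n) → Fin n × Fin n) (i : Fin n) : Fin n × Fin n :=
  pick (minimizers (W i) (greedySets W pick i).1 (greedySets W pick i).2)

/-- The weight of the triple with first index `i` that greedy adds. -/
def greedyWeight {n : ℕ} (W : Fin n → Fin n → Fin n → ℝ)
    (pick : Finset (Fin n × Fin n) → Fin n × Fin n) (i : Fin n) : ℝ :=
  W i (greedyPair W pick i).1 (greedyPair W pick i).2

/-- The `3 n ^ 2` random variables `a i j`, `b i k`, `c j k` are mutually independent and
uniformly distributed on `[0, 1]`. -/
structure IsIIDUniform {n : ℕ} {Ω : Type*} [MeasurableSpace Ω]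
    (a b c : Fin n → Fin n → Ω → ℝ) (P : Measure Ω) : Prop where
  measurable_a : ∀ i j, Measurable (a i j)
  measurable_b : ∀ i k, Measurable (b i k)
  measurable_c : ∀ j k, Measurable (c j k)
  uniform_a : ∀ i j, pdf.IsUniform (a i j) (Set.Icc 0 1) P volume
  uniform_b : ∀ i k, pdf.IsUniform (b i k) (Set.Icc 0 1) P volume
  uniform_c : ∀ j k, pdf.IsUniform (c j k) (Set.Icc 0 1) P volume
  indep : iIndepFun
    (Sum.elim (fun p : Fin n × Fin n => a p.1 p.2)
      (Sum.elim (fun p : Fin n × Fin n => b p.1 p.2) (fun p : Fin n × Fin n => c p.1 p.2))) P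

/-- The weight of the triple with first index `i` that greedy adds, as a random variable. -/
def randomGreedyWeight {n : ℕ} {Ω : Type*} (a b c : Fin n → Fin n → Ω → ℝ)
    (pick : Finset (Fin n × Fin n) → Fin n × Fin n) (i : Fin n) (ω : Ω) : ℝ :=
  greedyWeight
    (planarCost (fun i j => a i j ω) (fun i k => b i k ω) (fun j k => c j k ω)) pick i

/-- The constant `c₁ = 6 ^ (1/3) * Γ (4/3)`. -/
def greedyConst : ℝ := (6 : ℝ) ^ (1 / 3 : ℝ) * Real.Gamma (4 / 3)

end

/-! Suppose `r = n - i` indices remain when index `i : Fin n` is treated. If the `c`-values of the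
`r²` surviving pairs were fresh, all pairs would cost more than w with probability about exp(-r² w³
/ 6): three uniforms sum to at most w ≤ 1 with probability w³ / 6, and at this scale the dependence
between pairs sharing an `a`- or `b`-entry is negligible. Integrating over w gives (6 / r²)^(1/3)
Γ(4/3), the claimed bound. `lintegral_exp_neg_posPart_le` is the rigorous form, with `b` integrated
out before `a`.

The `c`-values are not fresh, since earlier rounds inspected them. Put τ = δ r^(-2/3) and call a
surviving pair clean if its `c`-value exceeds τ and, in every earlier round, its `a`- and
`b`-entries plus τ already exceed the chosen weight. Moving the `c`-values of clean pairs within (τ,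
∞) changes neither the history nor the clean set (`greedySets_congr`, `cleanPairs_congr`). Hence,
given the rows and the clean set, these values are independent and uniform above τ, and the only
price is a shift of the weight by τ (`dataMeasure_cleanPairs_inter_le`).

Nearly all surviving pairs are clean (`card_cleanPairs_ge`). Few have `c` ≤ τ, by a Chernoff bound
and a union bound over the possible surviving sets. Any other unclean pair has two small entries in
one earlier row, and only rounds with O(r) remaining indices (for fixed δ and `lam`) can be
responsible. This count presupposes control of the earlier weights, which the same tail bound
supplies: `dataMeasure_exists_badRound_le` sums over the first round that fails. With `lam = log n`
every failure has probability of order exp(-(log n)²), because r ≥ n^(1/4) lets r^(1/3) dominate all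
powers of log n. -/

noncomputable section

open scoped ENNReal

/-! ### Exponential moments of independent uniform variables -/

/-- The uniform distribution on `[0, 1]`. -/
def unitUniform : Measure ℝ := volume.restrict (Set.Icc 0 1)

instance : IsProbabilityMeasure unitUniform :=
  ⟨by simp [unitUniform]⟩

lemma unitUniform_Ioi_le {h : ℝ} (h0 : 0 ≤ h) :
    unitUniform (Set.Ioi h) = ENNReal.ofReal (1 - h) := by
  rw [unitUniform, Measure.restrict_apply measurableSet_Ioi]
  have : Set.Ioi h ∩ Set.Icc 0 1 = Set.Ioc h 1 := by
    ext y; simp only [Set.mem_inter_iff, Set.mem_Ioi, Set.mem_Icc, Set.mem_Ioc]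
    constructor
    · rintro ⟨h1, h2, h3⟩; exact ⟨h1, h3⟩
    · rintro ⟨h1, h3⟩; exact ⟨h1, by linarith, h3⟩
  rw [this, Real.volume_Ioc]

lemma integrable_unitUniform_of_bound {f : ℝ → ℝ} (hf : Measurable f) (C : ℝ)
    (h : ∀ y ∈ Set.Icc (0 : ℝ) 1, |f y| ≤ C) : Integrable f unitUniform := by
  refine Integrable.of_bound hf.aestronglyMeasurable C ?_
  rw [unitUniform, ae_restrict_iff' measurableSet_Icc]
  exact Filter.Eventually.of_forall fun y hy => h y hy

lemma ae_pi_unitUniform {ι : Type*} [Fintype ι] :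
    ∀ᵐ u ∂(Measure.pi fun _ : ι => unitUniform), ∀ i, u i ∈ Set.Icc (0 : ℝ) 1 := by
  rw [ae_all_iff]
  intro i
  have h : ∀ᵐ y ∂unitUniform, y ∈ Set.Icc (0 : ℝ) 1 := ae_restrict_mem measurableSet_Icc
  exact (Measure.tendsto_eval_ae_ae (μ := fun _ : ι => unitUniform) (i := i)).eventually h

/-- Since exp(-x) ≤ 1/(1+x), it suffices that (1+x)(1-(1-δ)x) = 1 + x(δ-(1-δ)x) is at least 1. The
factor 1-δ is the whole price of linearising the exponential. -/
lemma exp_neg_le_one_sub_mul {δ x : ℝ} (hx : 0 ≤ x) (hxδ : x ≤ δ) :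
    Real.exp (-x) ≤ 1 - (1 - δ) * x := by
  have h1 : 1 + x ≤ Real.exp x := by linarith [Real.add_one_le_exp x]
  have h2 : Real.exp (-x) ≤ (1 + x)⁻¹ := by
    rw [Real.exp_neg]; exact inv_anti₀ (by linarith) h1
  refine h2.trans ?_
  rw [inv_le_iff_one_le_mul₀ (by linarith)]
  nlinarith [mul_nonneg hx hx, mul_nonneg (mul_nonneg hx hx) (sub_nonneg.2 hxδ),
    mul_nonneg hx (sub_nonneg.2 hxδ), mul_nonneg (mul_nonneg hx hx) (hx.trans hxδ)]

lemma integral_pi_prod_le {ι : Type*} [Fintype ι] (f : ι → ℝ → ℝ) (b : ι → ℝ) (C : ℝ)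
    (hm : ∀ i, Measurable (f i)) (h0 : ∀ i y, 0 ≤ f i y)
    (hC : ∀ i, ∀ y ∈ Set.Icc (0 : ℝ) 1, f i y ≤ C)
    (hb : ∀ i, ∫ y, f i y ∂unitUniform ≤ b i) :
    ∫⁻ u, ENNReal.ofReal (∏ i, f i (u i)) ∂(Measure.pi fun _ : ι => unitUniform) ≤
      ENNReal.ofReal (∏ i, b i) := by
  rw [← ofReal_integral_eq_lintegral_ofReal]
  · rw [integral_fintype_prod_eq_prod (fun i => f i)]
    exact ENNReal.ofReal_le_ofReal (Finset.prod_le_prod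
      (fun i _ => integral_nonneg (h0 i)) fun i _ => hb i)
  · exact Integrable.fintype_prod (f := fun i => f i) fun i =>
      integrable_unitUniform_of_bound (hm i) C fun y hy => by
        rw [abs_of_nonneg (h0 i y)]; exact hC i y hy
  · exact Filter.Eventually.of_forall fun u => Finset.prod_nonneg fun i _ => h0 i _

/-- Bound for the Laplace transform of a sum of independent small
nonnegative functions. -/
lemma lintegral_exp_neg_sum_le {ι : Type*} [Fintype ι] {δ : ℝ} (g : ι → ℝ → ℝ)
    (hm : ∀ i, Measurable (g i))
    (h0 : ∀ i, ∀ y ∈ Set.Icc (0 : ℝ) 1, 0 ≤ g i y)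
    (hδ : ∀ i, ∀ y ∈ Set.Icc (0 : ℝ) 1, g i y ≤ δ) :
    ∫⁻ u, ENNReal.ofReal (Real.exp (-∑ i, g i (u i))) ∂(Measure.pi fun _ : ι => unitUniform) ≤
      ENNReal.ofReal (Real.exp (-((1 - δ) * ∑ i, ∫ y, g i y ∂unitUniform))) := by
  have key : ∀ i, ∫ y, Real.exp (-g i y) ∂unitUniform ≤
      Real.exp (-((1 - δ) * ∫ y, g i y ∂unitUniform)) := by
    intro i
    have hgi : Integrable (g i) unitUniform :=
      integrable_unitUniform_of_bound (hm i) δ fun y hy => by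
        rw [abs_of_nonneg (h0 i y hy)]; exact hδ i y hy
    calc ∫ y, Real.exp (-g i y) ∂unitUniform
        ≤ ∫ y, (1 - (1 - δ) * g i y) ∂unitUniform := by
          refine integral_mono_ae ?_ ((integrable_const _).sub (hgi.const_mul _)) ?_
          · refine integrable_unitUniform_of_bound (hm i).neg.exp 1 fun y hy => ?_
            rw [abs_of_pos (Real.exp_pos _)]
            exact Real.exp_le_one_iff.2 (by linarith [h0 i y hy])
          · rw [unitUniform, Filter.EventuallyLE, ae_restrict_iff' measurableSet_Icc]
            exact Filter.Eventually.of_forall fun y hy =>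
              exp_neg_le_one_sub_mul (h0 i y hy) (hδ i y hy)
      _ = 1 - (1 - δ) * ∫ y, g i y ∂unitUniform := by
          rw [integral_sub (integrable_const _) (hgi.const_mul _), integral_const_mul]
          simp
      _ ≤ _ := by
          linarith [Real.add_one_le_exp (-((1 - δ) * ∫ y, g i y ∂unitUniform))]
  have := integral_pi_prod_le (fun i y => Real.exp (-g i y)) _ 1 (fun i => (hm i).neg.exp)
    (fun i y => (Real.exp_pos _).le)
    (fun i y hy => Real.exp_le_one_iff.2 (by linarith [h0 i y hy])) key
  simpa only [← Real.exp_sum, Finset.sum_neg_distrib, ← Finset.mul_sum] using this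

/-- The condition s ≤ 1 keeps [0, s] inside the support. Negative s must be allowed, as s will be `w
- u j`. -/
lemma integral_posPart_sub_ge {s : ℝ} (hs : s ≤ 1) :
    (max s 0) ^ 2 / 2 ≤ ∫ y, max (s - y) 0 ∂unitUniform := by
  rcases le_total s 0 with h | h
  · rw [max_eq_right h]; simpa using integral_nonneg fun y => le_max_right (s - y) 0
  rw [max_eq_left h]
  have hi : IntegrableOn (fun y => max (s - y) 0) (Set.Icc 0 1) :=
    (Continuous.integrableOn_Icc (by fun_prop))
  calc s ^ 2 / 2 = ∫ y in (0 : ℝ)..s, (s - y) := by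
        rw [intervalIntegral.integral_sub (by simp) (by simp)]; simp; ring
    _ = ∫ y in Set.Icc 0 s, (s - y) := by
        rw [intervalIntegral.integral_of_le h, integral_Icc_eq_integral_Ioc]
    _ ≤ ∫ y in Set.Icc 0 s, max (s - y) 0 :=
        setIntegral_mono (Continuous.integrableOn_Icc (by fun_prop))
          (Continuous.integrableOn_Icc (by fun_prop)) fun y => le_max_left _ _
    _ ≤ ∫ y, max (s - y) 0 ∂unitUniform :=
        setIntegral_mono_set hi (Filter.Eventually.of_forall fun y => le_max_right _ _)
          (Set.Icc_subset_Icc_right hs).eventuallyLE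

lemma integral_posPart_sub_sq_ge {s : ℝ} (h : 0 ≤ s) (hs : s ≤ 1) :
    s ^ 3 / 3 ≤ ∫ y, (max (s - y) 0) ^ 2 ∂unitUniform := by
  have hi : IntegrableOn (fun y => (max (s - y) 0) ^ 2) (Set.Icc 0 1) :=
    (Continuous.integrableOn_Icc (by fun_prop))
  calc s ^ 3 / 3 = ∫ y in (0 : ℝ)..s, (s - y) ^ 2 := by
        have h := intervalIntegral.integral_comp_sub_left (a := 0) (b := s) (fun y => y ^ 2) s
        rw [h, integral_pow]; norm_num
    _ = ∫ y in Set.Icc 0 s, (s - y) ^ 2 := by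
        rw [intervalIntegral.integral_of_le h, integral_Icc_eq_integral_Ioc]
    _ = ∫ y in Set.Icc 0 s, (max (s - y) 0) ^ 2 :=
        setIntegral_congr_fun measurableSet_Icc fun y hy => by
          simp only [Set.mem_Icc] at hy
          rw [max_eq_left (by linarith)]
    _ ≤ ∫ y, (max (s - y) 0) ^ 2 ∂unitUniform :=
        setIntegral_mono_set hi (Filter.Eventually.of_forall fun y => sq_nonneg _)
          (Set.Icc_subset_Icc_right hs).eventuallyLE

/-- Chernoff bound for the number of coordinates in `B` that are at most `p`. -/
lemma pi_unitUniform_card_le {ι : Type*} [Fintype ι] [DecidableEq ι] (B : Finset ι) {p : ℝ}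
    (hp : 0 ≤ p) (t : ℝ) :
    (Measure.pi fun _ : ι => unitUniform) {u | t < ((B.filter fun i => u i ≤ p).card : ℝ)} ≤
      ENNReal.ofReal (Real.exp (2 * p * B.card - t)) := by
  -- Exponential moment with parameter 1: each coordinate in `B` contributes at most 1 + (e-1)p ≤
  -- exp(2p), by e - 1 ≤ 2.
  set f : ι → ℝ → ℝ := fun i y => if i ∈ B then Real.exp (Set.indicator (Set.Iic p) 1 y) else 1
    with hf
  have hfm : ∀ i, Measurable (f i) := by
    intro i
    by_cases hi : i ∈ B
    · simp only [hf, hi, if_true]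
      exact (measurable_one.indicator measurableSet_Iic).exp
    · simp only [hf, hi, if_false]; exact measurable_const
  have hprod : ∀ u : ι → ℝ, ∏ i, f i (u i) =
      Real.exp ((B.filter fun i => u i ≤ p).card : ℝ) := by
    intro u
    simp only [hf]
    rw [Finset.prod_ite_mem, Finset.univ_inter, ← Real.exp_sum]
    congr 1
    rw [Finset.card_filter]; push_cast
    exact Finset.sum_congr rfl fun i _ => by simp [Set.indicator_apply]
  have hint : ∀ i, ∫ y, f i y ∂unitUniform ≤ if i ∈ B then Real.exp (2 * p) else 1 := by
    intro i
    by_cases hi : i ∈ B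
    · simp only [hf, hi, if_true]
      have he : ∀ y : ℝ, Real.exp (Set.indicator (Set.Iic p) 1 y) =
          1 + Set.indicator (Set.Iic p) (fun _ => Real.exp 1 - 1) y := by
        intro y
        by_cases hy : y ∈ Set.Iic p <;> simp [hy]
      simp only [he]
      rw [integral_add (integrable_const _)
        ((integrable_const _).indicator measurableSet_Iic), integral_indicator_const _
          measurableSet_Iic]
      have hv : unitUniform.real (Set.Iic p) ≤ p := by
        rw [measureReal_def, unitUniform, Measure.restrict_apply measurableSet_Iic]
        refine ENNReal.toReal_le_of_le_ofReal hp ?_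
        calc volume (Set.Iic p ∩ Set.Icc 0 1) ≤ volume (Set.Icc 0 p) :=
              measure_mono fun y hy => ⟨hy.2.1, hy.1⟩
          _ = ENNReal.ofReal p := by simp
      have h1 : Real.exp 1 - 1 ≤ 2 := by linarith [Real.exp_one_lt_d9]
      have h2 : 0 ≤ Real.exp 1 - 1 := by linarith [Real.add_one_le_exp (1 : ℝ)]
      have h3 : unitUniform.real (Set.Iic p) * (Real.exp 1 - 1) ≤ p * 2 :=
        mul_le_mul hv h1 h2 hp
      simp only [integral_const, probReal_univ, smul_eq_mul, mul_one]
      linarith [Real.add_one_le_exp (2 * p)]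
    · simp [hf, hi]
  have hle := integral_pi_prod_le f _ (Real.exp 1) hfm
    (fun i y => by simp only [hf]; split_ifs <;> positivity)
    (fun i y _ => by
      simp only [hf]
      have : 1 ≤ Real.exp 1 := by linarith [Real.add_one_le_exp (1 : ℝ)]
      split_ifs
      · by_cases hy : y ∈ Set.Iic p <;> simp [hy]
      · exact this) hint
  rw [Finset.prod_ite_mem, Finset.univ_inter, Finset.prod_const, ← Real.exp_nat_mul] at hle
  simp only [hprod] at hle
  have hmeas : Measurable fun u : ι → ℝ =>
      ENNReal.ofReal (Real.exp ((B.filter fun i => u i ≤ p).card : ℝ)) := by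
    have : (fun u : ι → ℝ => Real.exp ((B.filter fun i => u i ≤ p).card : ℝ)) =
        fun u => ∏ i, f i (u i) := funext fun u => (hprod u).symm
    refine ENNReal.measurable_ofReal.comp ?_
    rw [this]
    exact Finset.measurable_prod _ fun i _ => (hfm i).comp (measurable_pi_apply i)
  have hmk := mul_meas_ge_le_lintegral₀ hmeas.aemeasurable (μ := Measure.pi fun _ : ι => unitUniform)
    (ENNReal.ofReal (Real.exp t))
  have hpos : ENNReal.ofReal (Real.exp t) ≠ 0 := by simp [Real.exp_pos]
  calc _ ≤ (Measure.pi fun _ : ι => unitUniform) {u | ENNReal.ofReal (Real.exp t) ≤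
        ENNReal.ofReal (Real.exp ((B.filter fun i => u i ≤ p).card : ℝ))} :=
        measure_mono fun u hu => ENNReal.ofReal_le_ofReal (Real.exp_le_exp.2 (le_of_lt hu))
    _ ≤ ENNReal.ofReal (Real.exp (B.card * (2 * p))) / ENNReal.ofReal (Real.exp t) := by
        rw [ENNReal.le_div_iff_mul_le (Or.inl hpos) (Or.inl ENNReal.ofReal_ne_top), mul_comm]
        exact hmk.trans hle
    _ = _ := by
        rw [← ENNReal.ofReal_div_of_pos (Real.exp_pos _), ← Real.exp_sub]
        congr 3; ring

/-- Regroup the exponent of a sum over a finite set of pairs according to one coordinate `π`,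
and apply `lintegral_exp_neg_sum_le`. -/
lemma lintegral_exp_neg_fiber_sum_le {α ι : Type*} [Fintype ι] [DecidableEq ι] {δ : ℝ}
    (hδ1 : δ ≤ 1) (D : Finset α) (π : α → ι) (h : α → ℝ → ℝ) (b : α → ℝ)
    (hm : ∀ p, Continuous (h p)) (h0 : ∀ p y, 0 ≤ h p y)
    (hδ : ∀ i, ∀ y ∈ Set.Icc (0 : ℝ) 1, ∑ p ∈ D with π p = i, h p y ≤ δ)
    (hb : ∀ p, b p ≤ ∫ y, h p y ∂unitUniform) :
    ∫⁻ u, ENNReal.ofReal (Real.exp (-∑ p ∈ D, h p (u (π p))))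
        ∂(Measure.pi fun _ : ι => unitUniform) ≤
      ENNReal.ofReal (Real.exp (-((1 - δ) * ∑ p ∈ D, b p))) := by
  have hsum : ∀ u : ι → ℝ, ∑ p ∈ D, h p (u (π p)) = ∑ i, ∑ p ∈ D with π p = i, h p (u i) := by
    intro u
    rw [← Finset.sum_fiberwise D π]
    refine Finset.sum_congr rfl fun i _ => Finset.sum_congr rfl fun p hp => ?_
    rw [(Finset.mem_filter.1 hp).2]
  simp only [hsum]
  refine (lintegral_exp_neg_sum_le (δ := δ) (fun i y => ∑ p ∈ D with π p = i, h p y)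
    (fun i => ?_) (fun i y _ => Finset.sum_nonneg fun p _ => h0 p y) hδ).trans ?_
  · exact Finset.measurable_sum _ fun p _ => (hm p).measurable
  refine ENNReal.ofReal_le_ofReal (Real.exp_le_exp.2 (neg_le_neg ?_))
  refine mul_le_mul_of_nonneg_left ?_ (by linarith)
  rw [← Finset.sum_fiberwise D π]
  refine Finset.sum_le_sum fun i _ => ?_
  have hi : ∀ p, Integrable (h p) unitUniform := fun p => by
    have : IntegrableOn (h p) (Set.Icc 0 1) := (hm p).integrableOn_Icc
    exact this
  rw [integral_finsetSum _ fun p _ => hi p]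
  exact Finset.sum_le_sum fun p _ => hb p

/-- Upper bound for the probability that all pairs of `D` have `u + v + c > w`, with `c` already
integrated out. -/
lemma lintegral_exp_neg_posPart_le {ι κ : Type*} [Fintype ι] [Fintype κ] [DecidableEq ι]
    [DecidableEq κ] (D : Finset (ι × κ)) (B : Finset ι) (r : ℕ) {δ w : ℝ}
    (hδ0 : 0 < δ) (hδ1 : δ ≤ 1) (hw0 : 0 < w) (hw1 : w ≤ 1) (hrw : r * w ^ 2 ≤ 2 * δ)
    (hB : B.card ≤ r) (hD : ∀ p ∈ D, p.1 ∈ B)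
    (hdeg : ∀ j, (D.filter fun p => p.1 = j).card ≤ r) :
    ∫⁻ u, ∫⁻ v, ENNReal.ofReal (Real.exp (-∑ p ∈ D, max (w - u p.1 - v p.2) 0))
        ∂(Measure.pi fun _ : κ => unitUniform) ∂(Measure.pi fun _ : ι => unitUniform) ≤
      ENNReal.ofReal (Real.exp (-((1 - δ) ^ 2 * D.card * w ^ 3 / 6))
        + Real.exp (2 * r * w - δ / w)) := by
  set μ := Measure.pi fun _ : ι => unitUniform
  have hinner : ∀ u : ι → ℝ, (∀ j, u j ∈ Set.Icc (0 : ℝ) 1) →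
      ¬ (δ / w < ((B.filter fun j => u j ≤ w).card : ℝ)) →
      ∫⁻ v, ENNReal.ofReal (Real.exp (-∑ p ∈ D, max (w - u p.1 - v p.2) 0))
        ∂(Measure.pi fun _ : κ => unitUniform) ≤
      ENNReal.ofReal (Real.exp (-∑ p ∈ D, (1 - δ) * ((max (w - u p.1) 0) ^ 2 / 2))) := by
    intro u hu hN
    rw [← Finset.mul_sum]
    refine lintegral_exp_neg_fiber_sum_le hδ1 D Prod.snd (fun p y => max (w - u p.1 - y) 0)
      (fun p => (max (w - u p.1) 0) ^ 2 / 2) (fun p => by fun_prop) (fun p y => le_max_right _ _)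
      ?_ fun p => integral_posPart_sub_ge (by linarith [(hu p.1).1])
    -- For fixed k a pair is determined by its first index j; only those with u j ≤ w contribute,
    -- each at most w. There are at most δ/w of them by `hN`.
    intro k y hy
    calc ∑ p ∈ D with p.2 = k, max (w - u p.1 - y) 0
        ≤ ∑ p ∈ D with p.2 = k, (if u p.1 ≤ w then w else 0) := by
          refine Finset.sum_le_sum fun p _ => ?_
          have := (hu p.1).1
          have := hy.1
          split_ifs with h
          · exact max_le (by linarith) hw0.le
          · exact max_le (by linarith) le_rfl
      _ = (((D.filter fun p => p.2 = k).filter fun p => u p.1 ≤ w).card : ℝ) * w := by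
          rw [← Finset.sum_filter, Finset.sum_const, nsmul_eq_mul]
      _ ≤ ((B.filter fun j => u j ≤ w).card : ℝ) * w := by
          refine mul_le_mul_of_nonneg_right ?_ hw0.le
          norm_cast
          refine Finset.card_le_card_of_injOn Prod.fst ?_ ?_
          · intro p hp
            simp only [Finset.coe_filter, Finset.mem_filter, Set.mem_ofPred_eq] at hp ⊢
            exact ⟨hD p hp.1.1, hp.2⟩
          · intro p hp q hq hpq
            simp only [Finset.coe_filter, Finset.mem_filter, Set.mem_ofPred_eq] at hp hq
            exact Prod.ext hpq (hp.1.2.trans hq.1.2.symm)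
      _ ≤ δ := by rwa [not_lt, le_div_iff₀ hw0] at hN
  have hsecond : ∫⁻ u, ENNReal.ofReal
        (Real.exp (-∑ p ∈ D, (1 - δ) * ((max (w - u p.1) 0) ^ 2 / 2))) ∂μ ≤
      ENNReal.ofReal (Real.exp (-((1 - δ) ^ 2 * D.card * w ^ 3 / 6))) := by
    refine (lintegral_exp_neg_fiber_sum_le hδ1 D Prod.fst
      (fun _ y => (1 - δ) * ((max (w - y) 0) ^ 2 / 2)) (fun _ => (1 - δ) * (w ^ 3 / 6))
      (fun p => by fun_prop) (fun p y => mul_nonneg (by linarith) (by positivity))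
      ?_ fun p => ?_).trans ?_
    -- At most r pairs share the index j and each contributes at most w²/2, so `hrw` bounds the
    -- fibre by δ.
    · intro j y hy
      rw [Finset.sum_const, nsmul_eq_mul]
      have h1 : (max (w - y) 0) ^ 2 ≤ w ^ 2 :=
        pow_le_pow_left₀ (le_max_right _ _) (max_le (by linarith [hy.1]) hw0.le) 2
      have h2 : ((D.filter fun p => p.1 = j).card : ℝ) ≤ r := by exact_mod_cast hdeg j
      calc _ ≤ (r : ℝ) * (1 * (w ^ 2 / 2)) := by
            refine mul_le_mul h2 (mul_le_mul (by linarith) (by linarith) (by positivity)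
              zero_le_one) (mul_nonneg (by linarith) (by positivity)) (by positivity)
        _ ≤ δ := by linarith
    · rw [integral_const_mul, integral_div]
      exact mul_le_mul_of_nonneg_left
        (by linarith [integral_posPart_sub_sq_ge hw0.le hw1]) (by linarith)
    · refine le_of_eq ?_
      rw [Finset.sum_const, nsmul_eq_mul]
      congr 3; ring
  have hmeas : MeasurableSet {u : ι → ℝ | δ / w < ((B.filter fun j => u j ≤ w).card : ℝ)} := by
    simp only [Finset.card_filter]
    push_cast
    refine measurableSet_lt measurable_const (Finset.measurable_sum _ fun j _ => ?_)
    exact Measurable.ite (measurableSet_le (measurable_pi_apply j) measurable_const)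
      measurable_const measurable_const
  calc _ ≤ ∫⁻ u, (ENNReal.ofReal
          (Real.exp (-∑ p ∈ D, (1 - δ) * ((max (w - u p.1) 0) ^ 2 / 2))) +
          Set.indicator {u : ι → ℝ | δ / w < ((B.filter fun j => u j ≤ w).card : ℝ)} 1 u) ∂μ := by
        refine lintegral_mono_ae ?_
        filter_upwards [ae_pi_unitUniform] with u hu
        -- For the exceptional u with too many small coordinates the inner integral is bounded by 1,
        -- which leaves only the Chernoff probability.
        by_cases hN : δ / w < ((B.filter fun j => u j ≤ w).card : ℝ)
        · rw [Set.indicator_of_mem (by exact hN), Pi.one_apply]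
          refine le_trans ?_ le_add_self
          calc _ ≤ ∫⁻ v, 1 ∂(Measure.pi fun _ : κ => unitUniform) := by
                refine lintegral_mono fun v => ?_
                rw [ENNReal.ofReal_le_one, Real.exp_le_one_iff, neg_nonpos]
                exact Finset.sum_nonneg fun p _ => le_max_right _ _
            _ = 1 := by simp
        · exact (hinner u hu hN).trans le_self_add
    _ ≤ _ := by
        rw [lintegral_add_right _ (measurable_one.indicator hmeas), lintegral_indicator_one hmeas,
          ENNReal.ofReal_add (Real.exp_nonneg _) (Real.exp_nonneg _)]
        refine add_le_add hsecond ((pi_unitUniform_card_le B hw0.le _).trans ?_)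
        refine ENNReal.ofReal_le_ofReal (Real.exp_le_exp.2 ?_)
        have : (B.card : ℝ) ≤ r := by exact_mod_cast hB
        nlinarith

/-! ### Stability of the greedy process under changes of costs -/

section Deterministic

variable {n : ℕ} {W W' : Fin n → Fin n → Fin n → ℝ} {pick : Finset (Fin n × Fin n) → Fin n × Fin n}

lemma mem_minimizers {w : Fin n → Fin n → ℝ} {B C : Finset (Fin n)} {p : Fin n × Fin n} :
    p ∈ minimizers w B C ↔ p ∈ B ×ˢ C ∧ ∀ q ∈ B ×ˢ C, w p.1 p.2 ≤ w q.1 q.2 := by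
  simp [minimizers]

lemma minimizers_nonempty {w : Fin n → Fin n → ℝ} {B C : Finset (Fin n)} (h : (B ×ˢ C).Nonempty) :
    (minimizers w B C).Nonempty := by
  obtain ⟨p, hp, hmin⟩ := Finset.exists_min_image (B ×ˢ C) (fun p => w p.1 p.2) h
  exact ⟨p, mem_minimizers.2 ⟨hp, hmin⟩⟩

lemma greedySets_succ (i : Fin n) :
    greedySets W pick (i + 1) = ((greedySets W pick i).1.erase (greedyPair W pick i).1,
      (greedySets W pick i).2.erase (greedyPair W pick i).2) := by
  rw [greedySets, dif_pos i.2]; rfl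

lemma greedyPair_mem_minimizers_of_nonempty (hp : IsTieBreak pick) (i : Fin n)
    (h : ((greedySets W pick i).1 ×ˢ (greedySets W pick i).2).Nonempty) :
    greedyPair W pick i ∈ minimizers (W i) (greedySets W pick i).1 (greedySets W pick i).2 :=
  hp _ (minimizers_nonempty h)

lemma card_greedySets (hp : IsTieBreak pick) : ∀ r ≤ n,
    (greedySets W pick r).1.card = n - r ∧ (greedySets W pick r).2.card = n - r := by
  intro r
  induction r with
  | zero => intro _; simp [greedySets]
  | succ r ih =>
    intro hr
    obtain ⟨h1, h2⟩ := ih (by omega)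
    have hne : ((greedySets W pick r).1 ×ˢ (greedySets W pick r).2).Nonempty := by
      rw [← Finset.card_pos, Finset.card_product, h1, h2]
      exact Nat.mul_pos (by omega) (by omega)
    have hm := (mem_minimizers.1
      (greedyPair_mem_minimizers_of_nonempty hp (W := W) ⟨r, hr⟩ hne)).1
    rw [Finset.mem_product] at hm
    rw [greedySets_succ ⟨r, hr⟩]
    simp only
    rw [Finset.card_erase_of_mem hm.1, Finset.card_erase_of_mem hm.2]
    simp only [h1, h2]
    omega

lemma greedySets_nonempty (hp : IsTieBreak pick) (i : Fin n) :
    ((greedySets W pick i).1 ×ˢ (greedySets W pick i).2).Nonempty := by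
  obtain ⟨h1, h2⟩ := card_greedySets (W := W) hp i i.2.le
  rw [← Finset.card_pos, Finset.card_product, h1, h2]
  have := i.2
  exact Nat.mul_pos (by omega) (by omega)

lemma greedyWeight_le (hp : IsTieBreak pick) (i : Fin n) {q : Fin n × Fin n}
    (hq : q ∈ (greedySets W pick i).1 ×ˢ (greedySets W pick i).2) :
    greedyWeight W pick i ≤ W i q.1 q.2 :=
  (mem_minimizers.1
    (greedyPair_mem_minimizers_of_nonempty hp i (greedySets_nonempty hp i))).2 q hq

lemma greedySets_antitone {r s : ℕ} (h : r ≤ s) :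
    (greedySets W pick s).1 ⊆ (greedySets W pick r).1 ∧
      (greedySets W pick s).2 ⊆ (greedySets W pick r).2 := by
  induction s, h using Nat.le_induction with
  | base => exact ⟨subset_rfl, subset_rfl⟩
  | succ s _ ih =>
    rw [greedySets]
    split_ifs
    · exact ⟨(Finset.erase_subset _ _).trans ih.1, (Finset.erase_subset _ _).trans ih.2⟩
    · exact ih

/-- The full sets of minimizers must agree, not just the minima, because the tie-breaking rule sees
the whole set. A minimizer `p` outside `D` beats every pair of `D` under both costs, so no pair of
`D` is a minimizer for either. -/
lemma minimizers_congr {w w' : Fin n → Fin n → ℝ} {B C : Finset (Fin n)}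
    {D : Finset (Fin n × Fin n)} {p : Fin n × Fin n} (hp : p ∈ minimizers w B C) (hpD : p ∉ D)
    (hw : ∀ q ∉ D, w q.1 q.2 = w' q.1 q.2) (h : ∀ q ∈ D, w p.1 p.2 < w q.1 q.2)
    (h' : ∀ q ∈ D, w p.1 p.2 < w' q.1 q.2) : minimizers w B C = minimizers w' B C := by
  rw [mem_minimizers] at hp
  have hp' : ∀ q ∈ B ×ˢ C, w p.1 p.2 ≤ w' q.1 q.2 := fun q hq => by
    by_cases hqD : q ∈ D
    · exact (h' q hqD).le
    · rw [← hw q hqD]; exact hp.2 q hq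
  ext q
  rw [mem_minimizers, mem_minimizers]
  constructor
  · rintro ⟨hq, hmin⟩
    have hqD : q ∉ D := fun hqD => absurd (hmin p hp.1) (not_le.2 (h q hqD))
    refine ⟨hq, fun s hs => ?_⟩
    rw [← hw q hqD]
    exact (hmin p hp.1).trans (hp' s hs)
  · rintro ⟨hq, hmin⟩
    have h1 := hmin p hp.1
    rw [← hw p hpD] at h1
    have hqD : q ∉ D := fun hqD => absurd h1 (not_le.2 (h' q hqD))
    refine ⟨hq, fun s hs => ?_⟩
    rw [← hw q hqD] at h1
    exact h1.trans (hp.2 s hs)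

/-- Costs of pairs that survive to round `i` do not influence the earlier rounds as long as they
exceed the weights chosen there. -/
lemma greedySets_congr (hp : IsTieBreak pick) (i : Fin n) {D : Finset (Fin n × Fin n)}
    (hw : ∀ l < i, ∀ q ∉ D, W l q.1 q.2 = W' l q.1 q.2)
    (h : ∀ l < i, ∀ q ∈ D, greedyWeight W pick l < W l q.1 q.2)
    (h' : ∀ l < i, ∀ q ∈ D, greedyWeight W pick l < W' l q.1 q.2) :
    ∀ r ≤ (i : ℕ), greedySets W' pick r = greedySets W pick r ∧
      ∀ l : Fin n, (l : ℕ) < r → greedyWeight W' pick l = greedyWeight W pick l := by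
  have hnot : ∀ l < i, greedyPair W pick l ∉ D := fun l hl hmem =>
    lt_irrefl _ (h l hl _ hmem)
  intro r
  induction r with
  | zero => intro _; exact ⟨rfl, fun l hl => absurd hl (by omega)⟩
  | succ r ih =>
    intro hr
    obtain ⟨ih1, ih2⟩ := ih (by omega)
    have hrn : r < n := by omega
    set l : Fin n := ⟨r, hrn⟩ with hl
    have hli : l < i := by rw [Fin.lt_def]; simp only [hl]; omega
    have ih1' : greedySets W' pick l = greedySets W pick l := ih1
    have hpair : greedyPair W' pick l = greedyPair W pick l := by
      rw [greedyPair, greedyPair, ih1']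
      rw [minimizers_congr (greedyPair_mem_minimizers_of_nonempty hp l (greedySets_nonempty hp l))
        (hnot l hli) (hw l hli) (h l hli) (h' l hli)]
    refine ⟨?_, fun s hs => ?_⟩
    · change greedySets W' pick ((l : ℕ) + 1) = greedySets W pick ((l : ℕ) + 1)
      rw [greedySets_succ, greedySets_succ, hpair, ih1']
    · rcases Nat.lt_succ_iff_lt_or_eq.1 hs with hs | hs
      · exact ih2 s hs
      · have : s = l := Fin.ext hs
        rw [this, greedyWeight, greedyWeight, hpair, ← hw l hli _ (hnot l hli)]

end Deterministic

/-! ### Cost data and clean pairs -/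

/-- A realisation of the random variables, with the `i`-th rows of `a` and `b` bundled. -/
abbrev CostData (n : ℕ) : Type := (Fin n → (Fin n → ℝ) × (Fin n → ℝ)) × (Fin n × Fin n → ℝ)

variable {n : ℕ}

def dataCost (x : CostData n) : Fin n → Fin n → Fin n → ℝ :=
  planarCost (fun i j => (x.1 i).1 j) (fun i k => (x.1 i).2 k) (fun j k => x.2 (j, k))

lemma dataCost_apply (x : CostData n) (i j k : Fin n) :
    dataCost x i j k = (x.1 i).1 j + (x.1 i).2 k + x.2 (j, k) := rfl

variable (pick : Finset (Fin n × Fin n) → Fin n × Fin n)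

def survivors (x : CostData n) (r : ℕ) : Finset (Fin n) × Finset (Fin n) :=
  greedySets (dataCost x) pick r

def roundWeight (x : CostData n) (i : Fin n) : ℝ := greedyWeight (dataCost x) pick i

open Classical in
/-- The surviving pairs whose `c`-value is only known to exceed `τ` given the first `i` rounds. -/
def cleanPairs (τ : ℝ) (x : CostData n) (i : Fin n) : Finset (Fin n × Fin n) :=
  ((survivors pick x i).1 ×ˢ (survivors pick x i).2).filter fun p =>
    τ < x.2 p ∧ ∀ l < i, roundWeight pick x l < (x.1 l).1 p.1 + (x.1 l).2 p.2 + τ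

variable {pick}

lemma mem_cleanPairs {τ : ℝ} {x : CostData n} {i : Fin n} {p : Fin n × Fin n} :
    p ∈ cleanPairs pick τ x i ↔
      p ∈ (survivors pick x i).1 ×ˢ (survivors pick x i).2 ∧ τ < x.2 p ∧
        ∀ l < i, roundWeight pick x l < (x.1 l).1 p.1 + (x.1 l).2 p.2 + τ := by
  simp [cleanPairs]

lemma survivors_congr_of_cleanPairs (hp : IsTieBreak pick) {τ : ℝ} {x x' : CostData n} {i : Fin n}
    (hrow : ∀ l < i, x.1 l = x'.1 l) (hoff : ∀ p ∉ cleanPairs pick τ x i, x.2 p = x'.2 p)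
    (hon : ∀ p ∈ cleanPairs pick τ x i, τ < x'.2 p) :
    survivors pick x' i = survivors pick x i ∧
      ∀ l < i, roundWeight pick x' l = roundWeight pick x l := by
  have := greedySets_congr (W := dataCost x) (W' := dataCost x') hp i
    (D := cleanPairs pick τ x i)
    (fun l hl q hq => by simp only [dataCost_apply, hrow l hl, hoff q hq])
    (fun l hl q hq => by
      have h := mem_cleanPairs.1 hq
      have h1 := h.2.2 l hl
      have h2 := h.2.1
      rw [dataCost_apply]
      change roundWeight pick x l < _
      linarith)
    (fun l hl q hq => by
      have h1 := (mem_cleanPairs.1 hq).2.2 l hl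
      have h2 := hon q hq
      rw [dataCost_apply, ← hrow l hl]
      change roundWeight pick x l < _
      linarith) i le_rfl
  exact this

/-- The clean set reproduces itself when its `c`-values are moved above τ, since the survivors and
earlier weights are unchanged. This is what makes {clean set = D} a half-line constraint on D
intersected with an event off D. -/
lemma cleanPairs_congr (hp : IsTieBreak pick) {τ : ℝ} {x x' : CostData n} {i : Fin n}
    (hrow : ∀ l < i, x.1 l = x'.1 l) (hoff : ∀ p ∉ cleanPairs pick τ x i, x.2 p = x'.2 p)
    (hon : ∀ p ∈ cleanPairs pick τ x i, τ < x'.2 p) :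
    cleanPairs pick τ x' i = cleanPairs pick τ x i := by
  obtain ⟨h1, h2⟩ := survivors_congr_of_cleanPairs hp hrow hoff hon
  ext p
  by_cases hpm : p ∈ cleanPairs pick τ x i
  · refine iff_of_true ?_ hpm
    have h := mem_cleanPairs.1 hpm
    refine mem_cleanPairs.2 ⟨h1 ▸ h.1, hon p hpm, fun l hl => ?_⟩
    rw [h2 l hl, ← hrow l hl]
    exact h.2.2 l hl
  · refine iff_of_false (fun h' => hpm ?_) hpm
    rw [mem_cleanPairs] at h' ⊢
    refine ⟨h1 ▸ h'.1, by rw [hoff p hpm]; exact h'.2.1, fun l hl => ?_⟩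
    rw [← h2 l hl, hrow l hl]
    exact h'.2.2 l hl

lemma survivors_congr_of_rows {x x' : CostData n} : ∀ {r : ℕ},
    (∀ l : Fin n, (l : ℕ) < r → x.1 l = x'.1 l) → x.2 = x'.2 →
    survivors pick x r = survivors pick x' r := by
  intro r
  induction r with
  | zero => intro _ _; rfl
  | succ r ih =>
    intro hrow hc
    have h := ih (fun l hl => hrow l (by omega)) hc
    unfold survivors at h ⊢
    rw [greedySets, greedySets]
    split_ifs with hr
    · have : dataCost x ⟨r, hr⟩ = dataCost x' ⟨r, hr⟩ := by
        ext j k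
        rw [dataCost_apply, dataCost_apply, hrow ⟨r, hr⟩ (Nat.lt_succ_self r), hc]
      rw [h, this]
    · exact h

lemma roundWeight_congr_of_rows {x x' : CostData n} {i : Fin n}
    (hrow : ∀ l ≤ i, x.1 l = x'.1 l) (hc : x.2 = x'.2) :
    roundWeight pick x i = roundWeight pick x' i := by
  have h := survivors_congr_of_rows (pick := pick) (r := i)
    (fun l hl => hrow l (Fin.le_def.2 hl.le)) hc
  have hW : dataCost x i = dataCost x' i := by
    ext j k
    rw [dataCost_apply, dataCost_apply, hrow i le_rfl, hc]
  unfold survivors at h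
  rw [roundWeight, roundWeight, greedyWeight, greedyWeight, greedyPair, greedyPair, h, hW]

lemma cleanPairs_congr_of_rows {τ : ℝ} {x x' : CostData n} {i : Fin n}
    (hrow : ∀ l < i, x.1 l = x'.1 l) (hc : x.2 = x'.2) :
    cleanPairs pick τ x i = cleanPairs pick τ x' i := by
  have h := survivors_congr_of_rows (pick := pick) (r := i)
    (fun l hl => hrow l (Fin.lt_def.2 hl)) hc
  ext p
  rw [mem_cleanPairs, mem_cleanPairs, h, hc]
  refine and_congr_right fun _ => and_congr_right fun _ => forall₂_congr fun l hl => ?_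
  rw [roundWeight_congr_of_rows (fun s hs => hrow s (lt_of_le_of_lt hs hl)) hc, hrow l hl]

/-! ### Measurability of the process -/

section Measurability

lemma measurable_dataCost (i j k : Fin n) : Measurable fun x : CostData n => dataCost x i j k := by
  simp only [dataCost_apply]
  fun_prop

lemma measurableSet_minimizers_eq (i : Fin n) (B C : Finset (Fin n)) (M : Finset (Fin n × Fin n)) :
    MeasurableSet {x : CostData n | minimizers (dataCost x i) B C = M} := by
  simp only [Finset.ext_iff, mem_minimizers]
  refine measurableSet_setOfPred.2 (Measurable.forall fun p => Measurable.iff ?_ measurable_const)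
  refine Measurable.and measurable_const (Measurable.forall fun q => Measurable.imp
    measurable_const (measurableSet_setOfPred.1 ?_))
  exact measurableSet_le (measurable_dataCost _ _ _) (measurable_dataCost _ _ _)

/-- The sets of minimizers and survivors take finitely many values, so the event is a finite union
over them. The rule `pick` acts on a finite type and can be arbitrary. -/
lemma measurableSet_survivors_eq : ∀ (r : ℕ) (s : Finset (Fin n) × Finset (Fin n)),
    MeasurableSet {x : CostData n | survivors pick x r = s} := by
  intro r
  induction r with
  | zero => intro s; exact MeasurableSet.const ((Finset.univ, Finset.univ) = s)
  | succ r ih =>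
    intro s
    by_cases hr : r < n
    · have : {x : CostData n | survivors pick x (r + 1) = s} =
          ⋃ t : Finset (Fin n) × Finset (Fin n), ⋃ M : Finset (Fin n × Fin n),
            {x : CostData n | survivors pick x r = t} ∩
              ({x | minimizers (dataCost x ⟨r, hr⟩) t.1 t.2 = M} ∩
              {_x | (t.1.erase (pick M).1, t.2.erase (pick M).2) = s}) := by
        ext x
        simp only [Set.mem_iUnion, Set.mem_inter_iff, Set.mem_ofPred_eq]
        constructor
        · intro h
          refine ⟨_, _, rfl, rfl, ?_⟩
          rw [← h, survivors, survivors, greedySets, dif_pos hr]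
        · rintro ⟨t, M, h1, h2, h3⟩
          rw [← h3, ← h2, ← h1, survivors, survivors, greedySets, dif_pos hr]
      rw [this]
      exact MeasurableSet.iUnion fun t => MeasurableSet.iUnion fun M =>
        (ih t).inter ((measurableSet_minimizers_eq _ _ _ _).inter (MeasurableSet.const _))
    · have : {x : CostData n | survivors pick x (r + 1) = s} = {x | survivors pick x r = s} := by
        ext x
        simp only [Set.mem_ofPred_eq]
        rw [survivors, survivors, greedySets, dif_neg hr]
      rw [this]; exact ih s

lemma measurableSet_of_survivors (i : ℕ) (A : Finset (Fin n) × Finset (Fin n) → Set (CostData n))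
    (hA : ∀ s, MeasurableSet (A s)) :
    MeasurableSet {x : CostData n | x ∈ A (survivors pick x i)} := by
  have : {x : CostData n | x ∈ A (survivors pick x i)} =
      ⋃ s, {x : CostData n | survivors pick x i = s} ∩ A s := by
    ext x; simp
  rw [this]
  exact MeasurableSet.iUnion fun s => (measurableSet_survivors_eq i s).inter (hA s)

lemma measurable_roundWeight (i : Fin n) :
    Measurable fun x : CostData n => roundWeight pick x i := by
  intro S hS
  have : (fun x : CostData n => roundWeight pick x i) ⁻¹' S =
      ⋃ s : Finset (Fin n) × Finset (Fin n), ⋃ M : Finset (Fin n × Fin n),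
        {x : CostData n | survivors pick x i = s} ∩
          ({x | minimizers (dataCost x i) s.1 s.2 = M} ∩
          (fun x => dataCost x i (pick M).1 (pick M).2) ⁻¹' S) := by
    ext x
    simp only [Set.mem_iUnion, Set.mem_inter_iff, Set.mem_ofPred_eq, Set.mem_preimage]
    constructor
    · intro h; exact ⟨_, _, rfl, rfl, h⟩
    · rintro ⟨s, M, h1, h2, h3⟩
      subst h1; subst h2; exact h3
  rw [this]
  exact MeasurableSet.iUnion fun t => MeasurableSet.iUnion fun M =>
    (measurableSet_survivors_eq _ t).inter ((measurableSet_minimizers_eq _ _ _ _).inter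
      (measurable_dataCost _ _ _ hS))

lemma measurableSet_cleanPairs_eq (τ : ℝ) (i : Fin n) (D : Finset (Fin n × Fin n)) :
    MeasurableSet {x : CostData n | cleanPairs pick τ x i = D} := by
  simp only [Finset.ext_iff, mem_cleanPairs]
  refine measurableSet_setOfPred.2 (Measurable.forall fun p => Measurable.iff ?_ measurable_const)
  refine Measurable.and ?_ (Measurable.and (measurableSet_setOfPred.1 ?_)
    (Measurable.forall fun l => Measurable.imp measurable_const (measurableSet_setOfPred.1 ?_)))
  · exact measurableSet_setOfPred.1 (measurableSet_of_survivors i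
      (fun s => {_x | p ∈ s.1 ×ˢ s.2}) fun s => MeasurableSet.const _)
  · exact measurableSet_lt measurable_const (by fun_prop)
  · exact measurableSet_lt (measurable_roundWeight l) (by fun_prop)

end Measurability

/-! ### Resampling coordinates and conditioning on the clean set -/

/-- Both integrands have the same marginal over coordinate i, because a second update at i erases
the first. -/
lemma lintegral_pi_eq_lintegral_update {ι : Type*} [Fintype ι] [DecidableEq ι] {α : ι → Type*}
    [∀ i, MeasurableSpace (α i)] (μ : ∀ i, Measure (α i)) [∀ i, IsProbabilityMeasure (μ i)]
    {f : (∀ i, α i) → ℝ≥0∞} (hf : Measurable f) (i : ι) :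
    ∫⁻ x, f x ∂Measure.pi μ = ∫⁻ x, ∫⁻ y, f (Function.update x i y) ∂μ i ∂Measure.pi μ := by
  have hs : ∀ x, (∫⋯∫⁻_{i}, f ∂μ) x = ∫⁻ y, f (Function.update x i y) ∂μ i :=
    fun x => lmarginal_singleton (μ := μ) f i ▸ rfl
  simp only [← hs]
  refine lintegral_eq_of_lmarginal_eq {i} hf (hf.lmarginal μ) ?_
  ext x
  rw [lmarginal_singleton (μ := μ) (∫⋯∫⁻_{i}, f ∂μ) i, hs]
  simp only [hs, Function.update_idem, lintegral_const, measure_univ, mul_one]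

/-- Events that do not involve the coordinates in `D` are independent of half-line constraints on
these coordinates. -/
lemma pi_unitUniform_inter_subtype {ι : Type*} [Fintype ι] (P : ι → Prop) [DecidablePred P]
    (h : ι → ℝ) {F : Set (ι → ℝ)} (hF : MeasurableSet F)
    (hFD : ∀ c c' : ι → ℝ, (∀ i, ¬ P i → c i = c' i) → c ∈ F → c' ∈ F) :
    (Measure.pi fun _ : ι => unitUniform) (F ∩ {c | ∀ d, P d → h d < c d}) =
      (Measure.pi fun _ : ι => unitUniform) F *
        ∏ d : {i // P i}, unitUniform (Set.Ioi (h d)) := by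
  set e := MeasurableEquiv.piEquivPiSubtypeProd (fun _ : ι => ℝ) P
  have he := measurePreserving_piEquivPiSubtypeProd (fun _ : ι => unitUniform) P
  set F' : Set ({i // ¬ P i} → ℝ) := {z | e.symm (0, z) ∈ F}
  have hF' : MeasurableSet F' := (e.symm.measurable.comp measurable_prodMk_left) hF
  have hoff : ∀ (y : {i // P i} → ℝ) (c : ι → ℝ), ∀ i, ¬ P i → e.symm (y, (e c).2) i = c i := by
    intro y c i hi
    simp [e, MeasurableEquiv.piEquivPiSubtypeProd, Equiv.piEquivPiSubtypeProd, hi]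
  have hmem : ∀ c, c ∈ F ↔ (e c).2 ∈ F' := fun c =>
    ⟨hFD _ _ fun i hi => (hoff 0 c i hi).symm, hFD _ _ fun i hi => hoff 0 c i hi⟩
  have h1 : F ∩ {c | ∀ d, P d → h d < c d} =
      e ⁻¹' ((Set.univ.pi fun d : {i // P i} => Set.Ioi (h d)) ×ˢ F') := by
    ext c
    simp only [Set.mem_inter_iff, Set.mem_ofPred_eq, Set.mem_preimage, Set.mem_prod, hmem c,
      Set.mem_pi, Set.mem_univ, true_imp_iff, Subtype.forall, Set.mem_Ioi]
    rw [and_comm]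
    rfl
  have h2 : F = e ⁻¹' (Set.univ ×ˢ F') := by
    ext c; simp [hmem c]
  have hA : MeasurableSet (Set.univ.pi fun d : {i // P i} => Set.Ioi (h d)) :=
    MeasurableSet.univ_pi fun _ => measurableSet_Ioi
  rw [h1, he.measure_preimage (hA.prod hF').nullMeasurableSet, Measure.prod_prod, Measure.pi_pi]
  conv_rhs => rw [h2, he.measure_preimage (MeasurableSet.univ.prod hF').nullMeasurableSet,
    Measure.prod_prod, measure_univ, one_mul]
  rw [mul_comm]

lemma pi_unitUniform_inter {ι : Type*} [Fintype ι] [DecidableEq ι] (D : Finset ι) (h : ι → ℝ)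
    {F : Set (ι → ℝ)} (hF : MeasurableSet F)
    (hFD : ∀ c c' : ι → ℝ, (∀ i ∉ D, c i = c' i) → c ∈ F → c' ∈ F) :
    (Measure.pi fun _ : ι => unitUniform) (F ∩ {c | ∀ d ∈ D, h d < c d}) =
      (Measure.pi fun _ : ι => unitUniform) F * ∏ d ∈ D, unitUniform (Set.Ioi (h d)) := by
  rw [pi_unitUniform_inter_subtype (· ∈ D) h hF hFD, Finset.prod_subtype D fun _ => Iff.rfl]

/-- The law of one row of `a` and of `b`. -/
def rowMeasure (n : ℕ) : Measure ((Fin n → ℝ) × (Fin n → ℝ)) :=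
  (Measure.pi fun _ => unitUniform).prod (Measure.pi fun _ => unitUniform)

instance : IsProbabilityMeasure (rowMeasure n) := by unfold rowMeasure; infer_instance

/-- The law of the cost data. -/
def dataMeasure (n : ℕ) : Measure (CostData n) :=
  (Measure.pi fun _ => rowMeasure n).prod (Measure.pi fun _ => unitUniform)

instance : IsProbabilityMeasure (dataMeasure n) := by unfold dataMeasure; infer_instance

/-- If membership of `E` is not affected by row `i`, then conditioning on `E` does not affect the
law of row `i`. -/
lemma dataMeasure_inter_row_le {E A : Set (CostData n)} (hE : MeasurableSet E)
    (hA : MeasurableSet A) (i : Fin n)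
    (hEi : ∀ x y, (Function.update x.1 i y, x.2) ∈ E ↔ x ∈ E) (q : ℝ≥0∞)
    (hq : ∀ x ∈ E, rowMeasure n {y | (Function.update x.1 i y, x.2) ∈ A} ≤ q) :
    dataMeasure n (E ∩ A) ≤ dataMeasure n E * q := by
  have hm : Measurable fun z : (Fin n × Fin n → ℝ) × (Fin n → (Fin n → ℝ) × (Fin n → ℝ)) =>
      (E ∩ A).indicator (1 : CostData n → ℝ≥0∞) (z.2, z.1) :=
    (measurable_one.indicator (hE.inter hA)).comp measurable_swap
  have hup : ∀ x : CostData n, Measurable fun y : (Fin n → ℝ) × (Fin n → ℝ) =>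
      ((Function.update x.1 i y, x.2) : CostData n) := fun x =>
    ((measurable_update x.1).prodMk measurable_const)
  have key : ∀ x : CostData n, ∫⁻ y, (E ∩ A).indicator (1 : CostData n → ℝ≥0∞)
      (Function.update x.1 i y, x.2) ∂rowMeasure n ≤ E.indicator 1 x * q := by
    intro x
    by_cases hx : x ∈ E
    · rw [Set.indicator_of_mem hx, Pi.one_apply, one_mul]
      refine le_trans (le_of_eq ?_) (hq x hx)
      change _ = rowMeasure n ((fun y => ((Function.update x.1 i y, x.2) : CostData n)) ⁻¹' A)
      rw [← lintegral_indicator_one (hup x hA)]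
      refine lintegral_congr fun y => ?_
      by_cases hy : ((Function.update x.1 i y, x.2) : CostData n) ∈ A
      · exact (Set.indicator_of_mem (s := E ∩ A) ⟨(hEi x y).2 hx, hy⟩ _).trans
          (Set.indicator_of_mem (s := (fun y => ((Function.update x.1 i y, x.2) : CostData n)) ⁻¹' A)
            hy (1 : (Fin n → ℝ) × (Fin n → ℝ) → ℝ≥0∞)).symm
      · exact (Set.indicator_of_notMem (s := E ∩ A) (fun h => hy h.2) _).trans
          (Set.indicator_of_notMem (s := (fun y => ((Function.update x.1 i y, x.2) : CostData n)) ⁻¹' A)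
            hy (1 : (Fin n → ℝ) × (Fin n → ℝ) → ℝ≥0∞)).symm
    · have : ∀ y, (E ∩ A).indicator (1 : CostData n → ℝ≥0∞) (Function.update x.1 i y, x.2) = 0 :=
        fun y => Set.indicator_of_notMem (fun h => hx ((hEi x y).1 h.1)) _
      simp [this]
  calc dataMeasure n (E ∩ A)
      = ∫⁻ x, (E ∩ A).indicator 1 x ∂dataMeasure n := by
        rw [lintegral_indicator_one (hE.inter hA)]
    _ = ∫⁻ c, ∫⁻ ρ, (E ∩ A).indicator 1 (ρ, c) ∂(Measure.pi fun _ => rowMeasure n)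
          ∂(Measure.pi fun _ => unitUniform) :=
        lintegral_prod_symm _ (measurable_one.indicator (hE.inter hA)).aemeasurable
    _ = ∫⁻ c, ∫⁻ ρ, ∫⁻ y, (E ∩ A).indicator 1 (Function.update ρ i y, c) ∂rowMeasure n
          ∂(Measure.pi fun _ => rowMeasure n) ∂(Measure.pi fun _ => unitUniform) := by
        refine lintegral_congr fun c => ?_
        exact lintegral_pi_eq_lintegral_update (fun _ => rowMeasure n)
          (hm.comp measurable_prodMk_left) i
    _ ≤ ∫⁻ c, ∫⁻ ρ, E.indicator 1 (ρ, c) * q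
          ∂(Measure.pi fun _ => rowMeasure n) ∂(Measure.pi fun _ => unitUniform) :=
        lintegral_mono fun c => lintegral_mono fun ρ => key (ρ, c)
    _ = ∫⁻ x, E.indicator 1 x * q ∂dataMeasure n :=
        (lintegral_prod_symm _
          ((measurable_one.indicator hE).mul_const q).aemeasurable).symm
    _ = _ := by rw [lintegral_mul_const _ (measurable_one.indicator hE),
          lintegral_indicator_one hE]

/-- Given the set `D` of clean pairs, the chance that round `i` has weight above `w` is at most
the chance for fresh rows and fresh `c`-values above `τ` on `D`. -/
lemma dataMeasure_cleanPairs_inter_le (hp : IsTieBreak pick) {τ w : ℝ} (hτ0 : 0 ≤ τ) (hτ1 : τ ≤ 1)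
    (i : Fin n) (D : Finset (Fin n × Fin n)) :
    dataMeasure n ({x | cleanPairs pick τ x i = D} ∩ {x | w < roundWeight pick x i}) ≤
      dataMeasure n {x | cleanPairs pick τ x i = D} *
        ∫⁻ u, ∫⁻ v, ENNReal.ofReal (Real.exp (-∑ p ∈ D, max (w - τ - u p.1 - v p.2) 0))
          ∂(Measure.pi fun _ => unitUniform) ∂(Measure.pi fun _ => unitUniform) := by
  set E : Set (CostData n) := {x | cleanPairs pick τ x i = D} with hEdef
  have hE : MeasurableSet E := measurableSet_cleanPairs_eq τ i D
  have hA : MeasurableSet {x : CostData n | w < roundWeight pick x i} :=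
    measurableSet_lt measurable_const (measurable_roundWeight i)
  set μc := Measure.pi fun _ : Fin n × Fin n => unitUniform with hμc
  set μr := Measure.pi fun _ : Fin n => rowMeasure n with hμr
  set q : (Fin n → ℝ) × (Fin n → ℝ) → ℝ≥0∞ := fun y =>
    ENNReal.ofReal (Real.exp (-∑ p ∈ D, max (w - τ - y.1 p.1 - y.2 p.2) 0)) with hq
  have hqm : Measurable q := by
    refine ENNReal.measurable_ofReal.comp (Real.measurable_exp.comp (Measurable.neg ?_))
    exact Finset.measurable_sum _ fun p _ => by fun_prop
  have hslice : ∀ ρ, μc (Prod.mk ρ ⁻¹' (E ∩ {x | w < roundWeight pick x i})) ≤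
      μc (Prod.mk ρ ⁻¹' E) * q (ρ i) := by
    intro ρ
    -- The value τ + 1 is an arbitrary representative above τ. Overwriting `D` with it yields an
    -- event `F` that ignores these coordinates.
    set ovr : (Fin n × Fin n → ℝ) → (Fin n × Fin n → ℝ) :=
      fun c p => if p ∈ D then τ + 1 else c p with hover
    have hoverm : Measurable ovr := by
      refine measurable_pi_lambda _ fun p => ?_
      by_cases hpD : p ∈ D
      · simp only [hover, hpD, if_true]; exact measurable_const
      · simp only [hover, hpD, if_false]; exact measurable_pi_apply p
    set F : Set (Fin n × Fin n → ℝ) := {c | (ρ, ovr c) ∈ E} with hFdef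
    have hF : MeasurableSet F := (measurable_prodMk_left.comp hoverm) hE
    have hFD : ∀ c c' : Fin n × Fin n → ℝ, (∀ p ∉ D, c p = c' p) → c ∈ F → c' ∈ F := by
      intro c c' hcc hc
      have : ovr c = ovr c' := by
        ext p; by_cases hpD : p ∈ D
        · simp [hover, hpD]
        · simp [hover, hpD, hcc p hpD]
      simpa only [hFdef, Set.mem_ofPred_eq, this] using hc
    have hEF : Prod.mk ρ ⁻¹' E = F ∩ {c | ∀ p ∈ D, τ < c p} := by
      ext c
      simp only [Set.mem_preimage, hEdef, hFdef, Set.mem_inter_iff, Set.mem_ofPred_eq]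
      constructor
      · intro h
        refine ⟨?_, fun p hpD => ?_⟩
        · rw [cleanPairs_congr hp (x := (ρ, c)) (x' := (ρ, ovr c)) (fun _ _ => rfl)]
          · exact h
          · intro p hpD; rw [h] at hpD; simp [hover, hpD]
          · intro p hpD; rw [h] at hpD; simp [hover, hpD]
        · rw [← h] at hpD; exact (mem_cleanPairs.1 hpD).2.1
      · rintro ⟨h, hc⟩
        rw [cleanPairs_congr hp (x := (ρ, ovr c)) (x' := (ρ, c)) (fun _ _ => rfl)]
        · exact h
        · intro p hpD; rw [h] at hpD; simp [hover, hpD]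
        · intro p hpD; rw [h] at hpD; exact hc p hpD
    have hsub : Prod.mk ρ ⁻¹' (E ∩ {x | w < roundWeight pick x i}) ⊆
        F ∩ {c | ∀ p ∈ D, max τ (w - (ρ i).1 p.1 - (ρ i).2 p.2) < c p} := by
      rintro c ⟨hcE, hcw⟩
      have hc : c ∈ Prod.mk ρ ⁻¹' E := hcE
      rw [hEF] at hc
      refine ⟨hc.1, fun p hpD => max_lt (hc.2 p hpD) ?_⟩
      have hcE' : cleanPairs pick τ (ρ, c) i = D := hcE
      rw [← hcE'] at hpD
      have h1 := greedyWeight_le (W := dataCost (ρ, c)) hp i (mem_cleanPairs.1 hpD).1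
      have h2 : w < greedyWeight (dataCost (ρ, c)) pick i := hcw
      rw [dataCost_apply] at h1
      simp only [Prod.mk.eta] at h1
      linarith
    calc μc (Prod.mk ρ ⁻¹' (E ∩ {x | w < roundWeight pick x i}))
        ≤ μc F * ∏ p ∈ D, unitUniform (Set.Ioi (max τ (w - (ρ i).1 p.1 - (ρ i).2 p.2))) :=
          (measure_mono hsub).trans (le_of_eq (pi_unitUniform_inter D _ hF hFD))
      -- With x = max s 0, the inequality is 1 - τ - x ≤ (1-τ)(1-x) ≤ (1-τ) exp(-x).
      _ ≤ μc F * ∏ p ∈ D, (unitUniform (Set.Ioi τ) * ENNReal.ofReal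
            (Real.exp (-max (w - τ - (ρ i).1 p.1 - (ρ i).2 p.2) 0))) := by
          gcongr with p hpD
          rw [unitUniform_Ioi_le hτ0, unitUniform_Ioi_le (hτ0.trans (le_max_left _ _)),
            ← ENNReal.ofReal_mul (by linarith)]
          refine ENNReal.ofReal_le_ofReal ?_
          set s := w - τ - (ρ i).1 p.1 - (ρ i).2 p.2 with hs
          have h1 : max τ (w - (ρ i).1 p.1 - (ρ i).2 p.2) = τ + max s 0 := by
            rw [← max_add_add_left, add_zero, max_comm]; congr 1; rw [hs]; ring
          rw [h1]
          have h2 := Real.add_one_le_exp (-max s 0)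
          have h3 : 0 ≤ max s 0 := le_max_right _ _
          nlinarith [mul_le_mul_of_nonneg_left h2 (sub_nonneg.2 hτ1), mul_nonneg hτ0 h3]
      _ = μc (Prod.mk ρ ⁻¹' E) * q (ρ i) := by
          rw [hEF, pi_unitUniform_inter D (fun _ => τ) hF hFD, Finset.prod_mul_distrib, mul_assoc]
          congr 2
          rw [hq]
          simp only
          rw [← Finset.sum_neg_distrib, Real.exp_sum, ENNReal.ofReal_prod_of_nonneg
            fun p _ => (Real.exp_pos _).le]
  -- The clean set before round i depends only on rows before i and on `c`, so row i may be
  -- integrated independently.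
  have hEi : ∀ (ρ : Fin n → (Fin n → ℝ) × (Fin n → ℝ)) y,
      Prod.mk (Function.update ρ i y) ⁻¹' E = Prod.mk ρ ⁻¹' E := by
    intro ρ y
    ext c
    simp only [Set.mem_preimage, hEdef, Set.mem_ofPred_eq]
    rw [cleanPairs_congr_of_rows (x := (Function.update ρ i y, c)) (x' := (ρ, c))
      (fun l hl => Function.update_of_ne hl.ne _ _) rfl]
  have hmE : Measurable fun ρ => μc (Prod.mk ρ ⁻¹' E) := measurable_measure_prodMk_left hE
  calc dataMeasure n (E ∩ {x | w < roundWeight pick x i})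
      = ∫⁻ ρ, μc (Prod.mk ρ ⁻¹' (E ∩ {x | w < roundWeight pick x i})) ∂μr :=
        Measure.prod_apply (hE.inter hA)
    _ ≤ ∫⁻ ρ, μc (Prod.mk ρ ⁻¹' E) * q (ρ i) ∂μr := lintegral_mono hslice
    _ = ∫⁻ ρ, ∫⁻ y, μc (Prod.mk ρ ⁻¹' E) * q y ∂rowMeasure n ∂μr := by
        have h := lintegral_pi_eq_lintegral_update (fun _ => rowMeasure n)
          (f := fun ρ => μc (Prod.mk ρ ⁻¹' E) * q (ρ i))
          (hmE.mul (hqm.comp (measurable_pi_apply i))) i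
        simpa only [hEi, Function.update_self] using h
    _ = ∫⁻ ρ, μc (Prod.mk ρ ⁻¹' E) * ∫⁻ y, q y ∂rowMeasure n ∂μr := by
        simp only [lintegral_const_mul _ hqm]
    _ = dataMeasure n E * ∫⁻ y, q y ∂rowMeasure n := by
        rw [lintegral_mul_const _ hmE, ← Measure.prod_apply hE]; rfl
    _ = _ := by
        rw [rowMeasure, lintegral_prod _ hqm.aemeasurable]

lemma measure_le_of_fibers {Ω β : Type*} [MeasurableSpace Ω] [Fintype β] (μ : Measure Ω)
    [IsProbabilityMeasure μ] (f : Ω → β) (hf : ∀ b, MeasurableSet {x | f x = b}) (S : Set Ω)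
    (q : ℝ≥0∞) (h : ∀ b, μ ({x | f x = b} ∩ S) ≤ μ {x | f x = b} * q) : μ S ≤ q := by
  classical
  calc μ S ≤ μ (⋃ b, {x | f x = b} ∩ S) :=
        measure_mono fun x hx => Set.mem_iUnion.2 ⟨f x, rfl, hx⟩
    _ ≤ ∑ b, μ ({x | f x = b} ∩ S) := measure_iUnion_fintype_le _ _
    _ ≤ ∑ b, μ {x | f x = b} * q := Finset.sum_le_sum fun b _ => h b
    _ = (∑ b, μ {x | f x = b}) * q := by rw [Finset.sum_mul]
    _ = μ (⋃ b, {x | f x = b}) * q := by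
        rw [measure_iUnion (fun a b hab => ?_) hf, tsum_fintype]
        exact Set.disjoint_left.2 fun x hx hx' => hab (hx.symm.trans hx')
    _ ≤ 1 * q := by gcongr; exact prob_le_one
    _ = q := one_mul q

/-! ### Counting clean pairs and the tail of one round -/

/-- The typical order of the weight of the round in which `r` indices remain. -/
def weightScale (r : ℕ) : ℝ := (r : ℝ) ^ (-(2 / 3) : ℝ)

lemma weightScale_pos {r : ℕ} (hr : 0 < r) : 0 < weightScale r :=
  Real.rpow_pos_of_pos (by exact_mod_cast hr) _

lemma card_survivors (hp : IsTieBreak pick) (x : CostData n) (i : Fin n) :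
    (survivors pick x i).1.card = n - i ∧ (survivors pick x i).2.card = n - i :=
  card_greedySets hp i i.2.le

lemma cleanPairs_tail_le (hp : IsTieBreak pick) {τ v δ : ℝ} (hτ0 : 0 ≤ τ) (hτ1 : τ ≤ 1)
    (hδ0 : 0 < δ) (hδ1 : δ ≤ 1) (hv0 : 0 < v) (hv1 : v ≤ 1) (i : Fin n)
    (hrv : (n - i : ℕ) * v ^ 2 ≤ 2 * δ) :
    dataMeasure n ({x | (1 - δ) * ((n - i : ℕ) : ℝ) ^ 2 ≤ ((cleanPairs pick τ x i).card : ℝ)} ∩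
        {x | τ + v < roundWeight pick x i}) ≤
      ENNReal.ofReal (Real.exp (-((1 - δ) ^ 3 * ((n - i : ℕ) : ℝ) ^ 2 * v ^ 3 / 6)) +
        Real.exp (2 * (n - i : ℕ) * v - δ / v)) := by
  refine measure_le_of_fibers _ (fun x => cleanPairs pick τ x i)
    (fun D => measurableSet_cleanPairs_eq τ i D) _ _ fun D => ?_
  -- The cardinality condition depends only on `D`: it holds on the whole fibre or nowhere on it.
  by_cases hD : ∃ x, cleanPairs pick τ x i = D ∧
      (1 - δ) * ((n - i : ℕ) : ℝ) ^ 2 ≤ ((cleanPairs pick τ x i).card : ℝ)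
  · obtain ⟨x, hx, hcard⟩ := hD
    rw [hx] at hcard
    obtain ⟨hc1, hc2⟩ := card_survivors hp x i
    have hsub : ∀ p ∈ D, p ∈ (survivors pick x i).1 ×ˢ (survivors pick x i).2 := fun p hpD => by
      rw [← hx] at hpD; exact (mem_cleanPairs.1 hpD).1
    calc _ ≤ dataMeasure n ({x | cleanPairs pick τ x i = D} ∩
            {x | τ + v < roundWeight pick x i}) :=
          measure_mono fun x hx => ⟨hx.1, hx.2.2⟩
      _ ≤ _ := dataMeasure_cleanPairs_inter_le hp hτ0 hτ1 i D
      _ ≤ _ := by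
          gcongr
          simp only [add_sub_cancel_left]
          refine (lintegral_exp_neg_posPart_le D (survivors pick x i).1 (n - i) hδ0 hδ1 hv0 hv1 hrv
            hc1.le (fun p hpD => (Finset.mem_product.1 (hsub p hpD)).1) fun j => ?_).trans ?_
          · rw [← hc2]
            refine Finset.card_le_card_of_injOn Prod.snd ?_ ?_
            · intro p hpj
              simp only [Finset.coe_filter, Set.mem_ofPred_eq] at hpj
              exact (Finset.mem_product.1 (hsub p hpj.1)).2
            · intro p hpj q hqj hpq
              simp only [Finset.coe_filter, Set.mem_ofPred_eq] at hpj hqj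
              exact Prod.ext (hpj.2.trans hqj.2.symm) hpq
          · refine ENNReal.ofReal_le_ofReal (add_le_add_left (Real.exp_le_exp.2 ?_) _)
            have h1 : (1 - δ) ^ 2 * ((1 - δ) * ((n - i : ℕ) : ℝ) ^ 2) * v ^ 3 ≤
                (1 - δ) ^ 2 * D.card * v ^ 3 := by gcongr
            linarith
  · have : {x | cleanPairs pick τ x i = D} ∩
        ({x | (1 - δ) * ((n - i : ℕ) : ℝ) ^ 2 ≤ ((cleanPairs pick τ x i).card : ℝ)} ∩
        {x | τ + v < roundWeight pick x i}) = ∅ := by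
      ext x
      simp only [Set.mem_inter_iff, Set.mem_ofPred_eq, Set.mem_empty_iff_false, iff_false]
      rintro ⟨h1, h2, -⟩
      exact hD ⟨x, h1, h2⟩
    rw [this, measure_empty]; exact zero_le

lemma measurableSet_card_filter_le {Ω ι : Type*} [MeasurableSpace Ω] [DecidableEq ι] (B : Finset ι)
    (f : ι → Ω → ℝ) (hf : ∀ j, Measurable (f j)) (p t : ℝ) :
    MeasurableSet {x | t < ((B.filter fun j => f j x ≤ p).card : ℝ)} := by
  simp only [Finset.card_filter]
  push_cast
  refine measurableSet_lt measurable_const (Finset.measurable_sum _ fun j _ => ?_)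
  exact Measurable.ite (measurableSet_le (hf j) measurable_const)
    measurable_const measurable_const

/-- The surviving second and third indices whose entries in row `i` of `a` and of `b` are at
most `L`. -/
def smallEntries (pick : Finset (Fin n × Fin n) → Fin n × Fin n) (L : ℝ) (x : CostData n)
    (i : Fin n) : Finset (Fin n) × Finset (Fin n) :=
  ((survivors pick x i).1.filter fun j => (x.1 i).1 j ≤ L,
    (survivors pick x i).2.filter fun k => (x.1 i).2 k ≤ L)

/-- Row i is independent of the survivors, which depend on earlier rows and `c` only. Hence the
Chernoff bound applies on each fibre, with exponent 2Lr - 8Lr for r = n - i. -/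
lemma smallEntries_tail_le (hp : IsTieBreak pick) {L : ℝ} (hL : 0 ≤ L) (i : Fin n) :
    dataMeasure n {x | 8 * L * (n - i : ℕ) < ((smallEntries pick L x i).1.card : ℝ)} ≤
        ENNReal.ofReal (Real.exp (-(6 * L * (n - i : ℕ)))) ∧
      dataMeasure n {x | 8 * L * (n - i : ℕ) < ((smallEntries pick L x i).2.card : ℝ)} ≤
        ENNReal.ofReal (Real.exp (-(6 * L * (n - i : ℕ)))) := by
  have hsurv : ∀ s, ∀ x y, (Function.update x.1 i y, x.2) ∈ {x : CostData n | survivors pick x i = s}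
      ↔ x ∈ {x : CostData n | survivors pick x i = s} := fun s x y => by
    simp only [Set.mem_ofPred_eq]
    rw [survivors_congr_of_rows (x := (Function.update x.1 i y, x.2)) (x' := x)
      (fun l hl => Function.update_of_ne (Fin.lt_def.2 hl).ne _ _) rfl]
  have hexp : 2 * L * ((n - i : ℕ) : ℝ) - 8 * L * (n - i : ℕ) = -(6 * L * (n - i : ℕ)) := by ring
  constructor
  · refine measure_le_of_fibers _ (fun x => survivors pick x i)
      (fun s => measurableSet_survivors_eq i s) _ _ fun s => ?_
    have hA : MeasurableSet {x : CostData n |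
        8 * L * (n - i : ℕ) < ((s.1.filter fun j => (x.1 i).1 j ≤ L).card : ℝ)} :=
      measurableSet_card_filter_le s.1 (fun j (x : CostData n) => (x.1 i).1 j)
        (fun j => by fun_prop) _ _
    refine le_trans (measure_mono ?_) (dataMeasure_inter_row_le
      (measurableSet_survivors_eq i s) hA i (hsurv s) _ fun x hx => ?_)
    · rintro x ⟨hx, h⟩
      refine ⟨hx, ?_⟩
      simp only [Set.mem_ofPred_eq] at hx
      simpa only [Set.mem_ofPred_eq, smallEntries, hx] using h
    · have hc := (card_survivors hp x i).1
      simp only [Set.mem_ofPred_eq] at hx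
      rw [hx] at hc
      simp only [Set.mem_ofPred_eq, Function.update_self]
      rw [← hexp, ← hc]
      refine le_trans (le_of_eq ?_) (pi_unitUniform_card_le s.1 hL _)
      have := Measure.prod_prod (μ := Measure.pi fun _ : Fin n => unitUniform)
        (ν := Measure.pi fun _ : Fin n => unitUniform)
        {u | 8 * L * (s.1.card : ℝ) < ((s.1.filter fun j => u j ≤ L).card : ℝ)} Set.univ
      rw [measure_univ, mul_one] at this
      rw [← this, rowMeasure]
      congr 1
      ext y; simp
  · refine measure_le_of_fibers _ (fun x => survivors pick x i)
      (fun s => measurableSet_survivors_eq i s) _ _ fun s => ?_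
    have hA : MeasurableSet {x : CostData n |
        8 * L * (n - i : ℕ) < ((s.2.filter fun j => (x.1 i).2 j ≤ L).card : ℝ)} :=
      measurableSet_card_filter_le s.2 (fun j (x : CostData n) => (x.1 i).2 j)
        (fun j => by fun_prop) _ _
    refine le_trans (measure_mono ?_) (dataMeasure_inter_row_le
      (measurableSet_survivors_eq i s) hA i (hsurv s) _ fun x hx => ?_)
    · rintro x ⟨hx, h⟩
      refine ⟨hx, ?_⟩
      simp only [Set.mem_ofPred_eq] at hx
      simpa only [Set.mem_ofPred_eq, smallEntries, hx] using h
    · have hc := (card_survivors hp x i).2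
      simp only [Set.mem_ofPred_eq] at hx
      rw [hx] at hc
      simp only [Set.mem_ofPred_eq, Function.update_self]
      rw [← hexp, ← hc]
      refine le_trans (le_of_eq ?_) (pi_unitUniform_card_le s.2 hL _)
      have := Measure.prod_prod (μ := Measure.pi fun _ : Fin n => unitUniform)
        (ν := Measure.pi fun _ : Fin n => unitUniform) Set.univ
        {u | 8 * L * (s.2.card : ℝ) < ((s.2.filter fun j => u j ≤ L).card : ℝ)}
      rw [measure_univ, one_mul] at this
      rw [← this, rowMeasure]
      congr 1
      ext y; simp

/-- The surviving pairs whose `c`-value is at most `τ`. -/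
def cheapPairs (pick : Finset (Fin n × Fin n) → Fin n × Fin n) (τ : ℝ) (x : CostData n)
    (i : Fin n) : Finset (Fin n × Fin n) :=
  ((survivors pick x i).1 ×ˢ (survivors pick x i).2).filter fun p => x.2 p ≤ τ

lemma dataMeasure_preimage_snd (A : Set (Fin n × Fin n → ℝ)) :
    dataMeasure n (Prod.snd ⁻¹' A) = (Measure.pi fun _ => unitUniform) A := by
  rw [← Set.univ_prod, dataMeasure, Measure.prod_prod, measure_univ, one_mul]

/-- More than `t` of the pairs in `s.1 ×ˢ s.2` have `c`-value at most `τ`. -/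
def manyCheap (τ t : ℝ) (s : Finset (Fin n) × Finset (Fin n)) : Set (Fin n × Fin n → ℝ) :=
  {c | t < (((s.1 ×ˢ s.2).filter fun p => c p ≤ τ).card : ℝ)}

lemma manyCheap_le {τ : ℝ} (hτ : 0 ≤ τ) (t : ℝ) (r : ℕ) (s : Finset (Fin n) × Finset (Fin n))
    (h1 : s.1.card = r) (h2 : s.2.card = r) :
    (Measure.pi fun _ => unitUniform) (manyCheap τ t s) ≤
      ENNReal.ofReal (Real.exp (2 * τ * (r : ℝ) ^ 2 - t)) := by
  have := pi_unitUniform_card_le (s.1 ×ˢ s.2) hτ t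
  rw [Finset.card_product, h1, h2, Nat.cast_mul, ← sq] at this
  exact this

/-- The survivors depend on `c`, so conditioning on them is not harmless here. The Chernoff bound is
instead taken for every fixed pair of r-subsets and summed over at most (n^r)² of them. -/
lemma cheapPairs_tail_le (hp : IsTieBreak pick) {τ : ℝ} (hτ : 0 ≤ τ) (t : ℝ) (i : Fin n) :
    dataMeasure n {x | t < ((cheapPairs pick τ x i).card : ℝ)} ≤
      ENNReal.ofReal (((n : ℝ) ^ (n - (i : ℕ))) ^ 2 *
        Real.exp (2 * τ * ((n - i : ℕ) : ℝ) ^ 2 - t)) := by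
  obtain ⟨r, hr⟩ : ∃ r : ℕ, r = n - (i : ℕ) := ⟨_, rfl⟩
  rw [← hr]
  obtain ⟨S, hSdef⟩ : ∃ S, S = (Finset.univ : Finset (Fin n)).powersetCard r := ⟨_, rfl⟩
  have hcard : ((S ×ˢ S).card : ℝ) ≤ ((n : ℝ) ^ r) ^ 2 := by
    have h : ((n.choose r : ℕ) : ℝ) ≤ (n : ℝ) ^ r := by
      rw [← Nat.cast_pow]
      exact Nat.cast_le.2 (Nat.choose_le_pow n r)
    have hS : S.card = n.choose r := by
      rw [hSdef, Finset.card_powersetCard, Finset.card_univ, Fintype.card_fin]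
    rw [Finset.card_product, hS, Nat.cast_mul, ← sq]
    exact pow_le_pow_left₀ (Nat.cast_nonneg _) h 2
  have hle : ∀ s ∈ S ×ˢ S, dataMeasure n (Prod.snd ⁻¹' manyCheap τ t s) ≤
      ENNReal.ofReal (Real.exp (2 * τ * (r : ℝ) ^ 2 - t)) := by
    intro s hs
    rw [Finset.mem_product, hSdef, Finset.mem_powersetCard, Finset.mem_powersetCard] at hs
    rw [dataMeasure_preimage_snd]
    exact manyCheap_le hτ t r s hs.1.2 hs.2.2
  have hsub : {x | t < ((cheapPairs pick τ x i).card : ℝ)} ⊆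
      ⋃ s ∈ S ×ˢ S, Prod.snd ⁻¹' manyCheap τ t s := by
    intro x hx
    simp only [Set.mem_iUnion]
    obtain ⟨h1, h2⟩ := card_survivors hp x i
    refine ⟨survivors pick x i, ?_, ?_⟩
    · rw [Finset.mem_product, hSdef, Finset.mem_powersetCard, Finset.mem_powersetCard, hr]
      exact ⟨⟨Finset.subset_univ _, h1⟩, Finset.subset_univ _, h2⟩
    · rw [Set.mem_ofPred_eq, cheapPairs] at hx
      rw [Set.mem_preimage, manyCheap, Set.mem_ofPred_eq]
      exact hx
  calc _ ≤ dataMeasure n (⋃ s ∈ S ×ˢ S, Prod.snd ⁻¹' manyCheap τ t s) := measure_mono hsub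
    _ ≤ ∑ s ∈ S ×ˢ S, dataMeasure n (Prod.snd ⁻¹' manyCheap τ t s) :=
        measure_biUnion_finset_le _ _
    _ ≤ ∑ s ∈ S ×ˢ S, ENNReal.ofReal (Real.exp (2 * τ * (r : ℝ) ^ 2 - t)) :=
        Finset.sum_le_sum hle
    _ = ENNReal.ofReal ((S ×ˢ S).card * Real.exp (2 * τ * (r : ℝ) ^ 2 - t)) := by
        rw [Finset.sum_const, nsmul_eq_mul, ENNReal.ofReal_mul (Nat.cast_nonneg _),
          ENNReal.ofReal_natCast]
    _ ≤ _ := ENNReal.ofReal_le_ofReal (mul_le_mul_of_nonneg_right hcard (Real.exp_nonneg _))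

/-- Numerical conditions under which the round with `r` remaining indices is under control:
`δ * weightScale r` is negligible and `lam * weightScale r` exceeds the weight of the round up to
probability of order `e`. -/
structure AdmissibleScale (n r : ℕ) (δ lam e : ℝ) : Prop where
  le_one : lam * weightScale r ≤ 1
  sq_le : r * (lam * weightScale r) ^ 2 ≤ 2 * δ
  exp_cube_le : Real.exp (-((1 - δ) ^ 3 * (r : ℝ) ^ 2 * ((lam - δ) * weightScale r) ^ 3 / 6)) ≤ e
  exp_count_le : Real.exp (2 * r * (lam * weightScale r) - δ / (lam * weightScale r)) ≤ e
  exp_small_le : Real.exp (-(6 * (lam * weightScale r) * r)) ≤ e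
  exp_cheap_le : ((n : ℝ) ^ r) ^ 2 *
    Real.exp (2 * (δ * weightScale r) * (r : ℝ) ^ 2 - δ * (r : ℝ) ^ 2 / 2) ≤ e
  near_le : 64 * (lam / δ) ^ 6 * lam ^ 2 * weightScale r ^ 2 * r ≤ δ / 2

lemma weightScale_anti {r s : ℕ} (hr : 0 < r) (h : r ≤ s) : weightScale s ≤ weightScale r :=
  Real.rpow_le_rpow_of_nonpos (by exact_mod_cast hr) (by exact_mod_cast h) (by norm_num)

/-- The sharp exponent of `lam / δ` is 3/2; the exponent 2 is a convenient weakening. -/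
lemma le_of_weightScale_le {r s : ℕ} {δ lam : ℝ} (hδ : 0 < δ) (hl : δ ≤ lam) (hr : 0 < r)
    (h : δ * weightScale r ≤ lam * weightScale s) : (s : ℝ) ≤ (lam / δ) ^ 2 * r := by
  by_contra! hlt
  set y := lam / δ with hy
  have hy1 : 1 ≤ y := (one_le_div hδ).2 hl
  have hr' : (0 : ℝ) < r := by exact_mod_cast hr
  have h1 : weightScale s < y⁻¹ * weightScale r := by
    calc weightScale s < (y ^ 2 * r) ^ (-(2 / 3) : ℝ) :=
          Real.rpow_lt_rpow_of_neg (by positivity) hlt (by norm_num)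
      _ = (y ^ 2) ^ (-(2 / 3) : ℝ) * weightScale r :=
          Real.mul_rpow (by positivity) hr'.le
      _ ≤ y⁻¹ * weightScale r := by
          refine mul_le_mul_of_nonneg_right ?_ (weightScale_pos hr).le
          rw [← Real.rpow_natCast, ← Real.rpow_mul (by positivity), ← Real.rpow_neg_one]
          exact Real.rpow_le_rpow_of_exponent_le hy1 (by norm_num)
  have h2 : lam * weightScale s < lam * (y⁻¹ * weightScale r) :=
    mul_lt_mul_of_pos_left h1 (by linarith)
  have h3 : lam * (y⁻¹ * weightScale r) = δ * weightScale r := by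
    have hl0 : lam ≠ 0 := by linarith
    rw [hy]; field_simp
  linarith

lemma card_cleanPairs_ge (hp : IsTieBreak pick) {δ lam : ℝ} (hδ : 0 < δ) (hl : δ ≤ lam)
    {x : CostData n} (hx : ∀ l j, 0 ≤ (x.1 l).1 j ∧ 0 ≤ (x.1 l).2 j) {i : Fin n}
    (hnear : 64 * (lam / δ) ^ 6 * lam ^ 2 * weightScale (n - i) ^ 2 * (n - i : ℕ) ≤ δ / 2)
    (hW : ∀ l < i, roundWeight pick x l ≤ lam * weightScale (n - l))
    (h1 : ∀ l < i, ((smallEntries pick (lam * weightScale (n - l)) x l).1.card : ℝ) ≤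
      8 * (lam * weightScale (n - l)) * (n - l : ℕ))
    (h2 : ∀ l < i, ((smallEntries pick (lam * weightScale (n - l)) x l).2.card : ℝ) ≤
      8 * (lam * weightScale (n - l)) * (n - l : ℕ))
    (hcheap : ((cheapPairs pick (δ * weightScale (n - i)) x i).card : ℝ) ≤
      δ * ((n - i : ℕ) : ℝ) ^ 2 / 2) :
    (1 - δ) * ((n - i : ℕ) : ℝ) ^ 2 ≤
      ((cleanPairs pick (δ * weightScale (n - i)) x i).card : ℝ) := by
  classical
  obtain ⟨r, hr⟩ : ∃ r : ℕ, r = n - (i : ℕ) := ⟨_, rfl⟩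
  have hr0 : 0 < r := by have := i.2; omega
  rw [← hr] at hnear hcheap ⊢
  have hs := weightScale_pos hr0
  set s := weightScale r with hsdef
  set K := (lam / δ) ^ 2 with hK
  have hlam : 0 < lam := hδ.trans_le hl
  have hK0 : 0 < K := by positivity
  -- The earlier rounds whose weight may exceed τ = δs. Since l ↦ n - l is injective and lands in
  -- [1, K r], there are at most K r of them.
  set near : Finset (Fin n) := Finset.univ.filter fun l =>
    l < i ∧ δ * s ≤ lam * weightScale (n - l) with hnearS
  have hnearK : ∀ l ∈ near, ((n - l : ℕ) : ℝ) ≤ K * r := fun l hl' =>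
    le_of_weightScale_le hδ hl hr0 (Finset.mem_filter.1 hl').2.2
  have hcardnear : (near.card : ℝ) ≤ K * r := by
    have : near.card ≤ (Finset.Icc 1 ⌊K * r⌋₊).card := by
      refine Finset.card_le_card_of_injOn (fun l : Fin n => n - (l : ℕ)) ?_ ?_
      · intro l hl'
        have h := hnearK l hl'
        have := l.2
        simp only [Finset.coe_Icc, Set.mem_Icc]
        exact ⟨by omega, Nat.le_floor h⟩
      · intro a _ b _ hab
        have := a.2
        have := b.2
        simp only at hab
        exact Fin.ext (by omega)
    rw [Nat.card_Icc, Nat.add_sub_cancel] at this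
    exact (Nat.cast_le.2 this).trans (Nat.floor_le (by positivity))
  -- If a pair is neither clean nor cheap, some earlier round l has a + b + τ ≤ W_l ≤ lam ·
  -- `weightScale (n - l)`. All three summands are nonnegative, so both entries are small and l is
  -- near.
  have hcover : (survivors pick x i).1 ×ˢ (survivors pick x i).2 ⊆
      cleanPairs pick (δ * s) x i ∪ (cheapPairs pick (δ * s) x i ∪
        near.biUnion fun l => (smallEntries pick (lam * weightScale (n - l)) x l).1 ×ˢ
          (smallEntries pick (lam * weightScale (n - l)) x l).2) := by
    intro p hpP
    by_cases hc : x.2 p ≤ δ * s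
    · exact Finset.mem_union_right _ (Finset.mem_union_left _ (Finset.mem_filter.2 ⟨hpP, hc⟩))
    by_cases hcl : p ∈ cleanPairs pick (δ * s) x i
    · exact Finset.mem_union_left _ hcl
    refine Finset.mem_union_right _ (Finset.mem_union_right _ ?_)
    rw [mem_cleanPairs] at hcl
    push Not at hcl hc
    obtain ⟨l, hli, hle⟩ := hcl hpP hc
    have hWl := hW l hli
    have ha := (hx l p.1).1
    have hb := (hx l p.2).2
    have hs0 : 0 < δ * s := by positivity
    have hanti := greedySets_antitone (W := dataCost x) (pick := pick) (Fin.lt_def.1 hli).le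
    rw [Finset.mem_product] at hpP
    refine Finset.mem_biUnion.2 ⟨l, ?_, Finset.mem_product.2
      ⟨Finset.mem_filter.2 ⟨hanti.1 hpP.1, ?_⟩, Finset.mem_filter.2 ⟨hanti.2 hpP.2, ?_⟩⟩⟩
    · exact Finset.mem_filter.2 ⟨Finset.mem_univ _, hli, by linarith⟩
    · linarith
    · linarith
  have hterm : ∀ l ∈ near, (((smallEntries pick (lam * weightScale (n - l)) x l).1 ×ˢ
      (smallEntries pick (lam * weightScale (n - l)) x l).2).card : ℝ) ≤
        (8 * (lam * s) * (K * r)) ^ 2 := by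
    intro l hl'
    have hli := (Finset.mem_filter.1 hl').2.1
    have hrl : r ≤ n - (l : ℕ) := by have := Fin.lt_def.1 hli; omega
    have hsl : weightScale (n - l) ≤ s := weightScale_anti hr0 hrl
    have hb : 8 * (lam * weightScale (n - l)) * ((n - l : ℕ) : ℝ) ≤ 8 * (lam * s) * (K * r) := by
      have := hnearK l hl'
      gcongr
    rw [Finset.card_product, Nat.cast_mul, sq]
    exact mul_le_mul ((h1 l hli).trans hb) ((h2 l hli).trans hb) (Nat.cast_nonneg _)
      (by positivity)
  have hfar : ((near.biUnion fun l => (smallEntries pick (lam * weightScale (n - l)) x l).1 ×ˢ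
          (smallEntries pick (lam * weightScale (n - l)) x l).2).card : ℝ) ≤
      δ / 2 * (r : ℝ) ^ 2 := by
    calc _ ≤ ((∑ l ∈ near, ((smallEntries pick (lam * weightScale (n - l)) x l).1 ×ˢ
          (smallEntries pick (lam * weightScale (n - l)) x l).2).card : ℕ) : ℝ) :=
          Nat.cast_le.2 Finset.card_biUnion_le
      _ ≤ ∑ l ∈ near, (8 * (lam * s) * (K * r)) ^ 2 := by
          rw [Nat.cast_sum]; exact Finset.sum_le_sum hterm
      _ = near.card * (8 * (lam * s) * (K * r)) ^ 2 := by rw [Finset.sum_const, nsmul_eq_mul]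
      _ ≤ K * r * (8 * (lam * s) * (K * r)) ^ 2 := by gcongr
      _ = 64 * (lam / δ) ^ 6 * lam ^ 2 * s ^ 2 * r * (r : ℝ) ^ 2 := by rw [hK]; ring
      _ ≤ δ / 2 * (r : ℝ) ^ 2 := by gcongr
  have hP : (((survivors pick x i).1 ×ˢ (survivors pick x i).2).card : ℝ) = (r : ℝ) ^ 2 := by
    rw [Finset.card_product, (card_survivors hp x i).1, (card_survivors hp x i).2, ← hr]
    push_cast; ring
  have htot : (((survivors pick x i).1 ×ˢ (survivors pick x i).2).card : ℝ) ≤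
      (cleanPairs pick (δ * s) x i).card + ((cheapPairs pick (δ * s) x i).card +
        (near.biUnion fun l => (smallEntries pick (lam * weightScale (n - l)) x l).1 ×ˢ
          (smallEntries pick (lam * weightScale (n - l)) x l).2).card) := by
    have h := (Finset.card_le_card hcover).trans ((Finset.card_union_le _ _).trans
      (Nat.add_le_add_left (Finset.card_union_le _ _) _))
    exact_mod_cast h
  linarith

/-! ### Induction over rounds through the first bad round -/

/-- Round `l` has a large weight, or many small entries, or many surviving pairs with small
`c`-value. -/
def BadRound (pick : Finset (Fin n × Fin n) → Fin n × Fin n) (δ lam : ℝ) (x : CostData n)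
    (l : Fin n) : Prop :=
  lam * weightScale (n - l) < roundWeight pick x l ∨
  8 * (lam * weightScale (n - l)) * (n - l : ℕ) <
    ((smallEntries pick (lam * weightScale (n - l)) x l).1.card : ℝ) ∨
  8 * (lam * weightScale (n - l)) * (n - l : ℕ) <
    ((smallEntries pick (lam * weightScale (n - l)) x l).2.card : ℝ) ∨
  δ * ((n - l : ℕ) : ℝ) ^ 2 / 2 < ((cheapPairs pick (δ * weightScale (n - l)) x l).card : ℝ)

lemma ae_dataMeasure_mem_Icc : ∀ᵐ x ∂dataMeasure n,
    (∀ l j, (x.1 l).1 j ∈ Set.Icc (0 : ℝ) 1 ∧ (x.1 l).2 j ∈ Set.Icc (0 : ℝ) 1) ∧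
      ∀ p, x.2 p ∈ Set.Icc (0 : ℝ) 1 := by
  have hu := ae_pi_unitUniform (ι := Fin n)
  have hc := ae_pi_unitUniform (ι := Fin n × Fin n)
  have hrow : ∀ᵐ y ∂rowMeasure n,
      (∀ j, y.1 j ∈ Set.Icc (0 : ℝ) 1) ∧ ∀ j, y.2 j ∈ Set.Icc (0 : ℝ) 1 :=
    (Measure.quasiMeasurePreserving_fst.ae hu).and (Measure.quasiMeasurePreserving_snd.ae hu)
  have hrows : ∀ᵐ ρ ∂(Measure.pi fun _ : Fin n => rowMeasure n), ∀ l,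
      (∀ j, (ρ l).1 j ∈ Set.Icc (0 : ℝ) 1) ∧ ∀ j, (ρ l).2 j ∈ Set.Icc (0 : ℝ) 1 := by
    rw [ae_all_iff]
    intro l
    exact (Measure.tendsto_eval_ae_ae (μ := fun _ : Fin n => rowMeasure n) (i := l)).eventually hrow
  filter_upwards [Measure.quasiMeasurePreserving_fst.ae hrows,
    Measure.quasiMeasurePreserving_snd.ae hc] with x h1 h2
  exact ⟨fun l j => ⟨(h1 l).1 j, (h1 l).2 j⟩, h2⟩

/-- Round i itself contributes only the cheap-pair condition; its weight is not assumed small. The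
bound can therefore be used to estimate that weight. -/
lemma clean_of_not_badRound (hp : IsTieBreak pick) {δ lam e : ℝ} (hδ : 0 < δ) (hl : δ ≤ lam)
    {x : CostData n} (hx : ∀ l j, (x.1 l).1 j ∈ Set.Icc (0 : ℝ) 1 ∧ (x.1 l).2 j ∈ Set.Icc (0 : ℝ) 1)
    {i : Fin n} (hi : AdmissibleScale n (n - i) δ lam e) (hgood : ∀ l < i, ¬ BadRound pick δ lam x l)
    (hcheap : ((cheapPairs pick (δ * weightScale (n - i)) x i).card : ℝ) ≤
      δ * ((n - i : ℕ) : ℝ) ^ 2 / 2) :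
    (1 - δ) * ((n - i : ℕ) : ℝ) ^ 2 ≤
      ((cleanPairs pick (δ * weightScale (n - i)) x i).card : ℝ) := by
  simp only [BadRound, not_or, not_lt] at hgood
  exact card_cleanPairs_ge hp hδ hl (fun l j => ⟨(hx l j).1.1, (hx l j).2.1⟩) hi.near_le
    (fun l hli => (hgood l hli).1) (fun l hli => (hgood l hli).2.1)
    (fun l hli => (hgood l hli).2.2.1) hcheap

lemma roundWeight_tail_of_clean (hp : IsTieBreak pick) {δ lam e v : ℝ} (hδ : 0 < δ) (hδ1 : δ ≤ 1)
    (hl : δ < lam) {i : Fin n} (hi : AdmissibleScale n (n - i) δ lam e) (hv0 : 0 < v)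
    (hv : v ≤ lam * weightScale (n - i)) :
    dataMeasure n ({x | (1 - δ) * ((n - i : ℕ) : ℝ) ^ 2 ≤
          ((cleanPairs pick (δ * weightScale (n - i)) x i).card : ℝ)} ∩
        {x | δ * weightScale (n - i) + v < roundWeight pick x i}) ≤
      ENNReal.ofReal (Real.exp (-((1 - δ) ^ 3 * ((n - i : ℕ) : ℝ) ^ 2 * v ^ 3 / 6)) + e) := by
  have hs : 0 < weightScale (n - i) := weightScale_pos (by have := i.2; omega)
  have hτ : δ * weightScale (n - i) ≤ lam * weightScale (n - i) := by gcongr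
  refine (cleanPairs_tail_le hp (by positivity) (hτ.trans hi.le_one) hδ hδ1 hv0
    (hv.trans hi.le_one) i (le_trans (by gcongr) hi.sq_le)).trans (ENNReal.ofReal_le_ofReal ?_)
  refine add_le_add_right (le_trans (Real.exp_le_exp.2 ?_) hi.exp_count_le) _
  gcongr

lemma dataMeasure_badRound_le (hp : IsTieBreak pick) {δ lam e : ℝ} (hδ : 0 < δ) (hδ1 : δ ≤ 1)
    (hl : δ < lam) {i : Fin n} (hi : AdmissibleScale n (n - i) δ lam e) :
    dataMeasure n {x | BadRound pick δ lam x i ∧ ∀ l < i, ¬ BadRound pick δ lam x l} ≤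
      ENNReal.ofReal (5 * e) := by
  have hs : 0 < weightScale (n - i) := weightScale_pos (by have := i.2; omega)
  have hlam : 0 < lam := hδ.trans hl
  have he : 0 ≤ e := (Real.exp_nonneg _).trans hi.exp_count_le
  set s := weightScale (n - i) with hsdef
  have hv : dataMeasure n ({x | (1 - δ) * ((n - i : ℕ) : ℝ) ^ 2 ≤
          ((cleanPairs pick (δ * s) x i).card : ℝ)} ∩
        {x | lam * s < roundWeight pick x i}) ≤ ENNReal.ofReal (2 * e) := by
    have h := roundWeight_tail_of_clean hp hδ hδ1 hl hi (v := (lam - δ) * s)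
      (mul_pos (by linarith) hs) (by rw [← hsdef]; nlinarith)
    rw [← hsdef] at h
    have h3 : δ * s + (lam - δ) * s = lam * s := by ring
    rw [h3] at h
    refine h.trans (ENNReal.ofReal_le_ofReal ?_)
    linarith [hi.exp_cube_le]
  have hsm := smallEntries_tail_le hp (L := lam * s) (by positivity) i
  have hsm1 := hsm.1.trans (ENNReal.ofReal_le_ofReal hi.exp_small_le)
  have hsm2 := hsm.2.trans (ENNReal.ofReal_le_ofReal hi.exp_small_le)
  have hch := (cheapPairs_tail_le hp (τ := δ * s) (by positivity)
    (δ * ((n - i : ℕ) : ℝ) ^ 2 / 2) i).trans (ENNReal.ofReal_le_ofReal hi.exp_cheap_le)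
  calc _ ≤ dataMeasure n (({x | (1 - δ) * ((n - i : ℕ) : ℝ) ^ 2 ≤
              ((cleanPairs pick (δ * s) x i).card : ℝ)} ∩
            {x | lam * s < roundWeight pick x i}) ∪
          ({x | 8 * (lam * s) * (n - i : ℕ) < ((smallEntries pick (lam * s) x i).1.card : ℝ)} ∪
          ({x | 8 * (lam * s) * (n - i : ℕ) < ((smallEntries pick (lam * s) x i).2.card : ℝ)} ∪
          {x | δ * ((n - i : ℕ) : ℝ) ^ 2 / 2 < ((cheapPairs pick (δ * s) x i).card : ℝ)}))) := by
        refine measure_mono_ae ?_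
        filter_upwards [ae_dataMeasure_mem_Icc] with x hx
        rintro ⟨hbad, hgood⟩
        by_cases hc : δ * ((n - i : ℕ) : ℝ) ^ 2 / 2 < ((cheapPairs pick (δ * s) x i).card : ℝ)
        · exact Or.inr (Or.inr (Or.inr hc))
        rcases hbad with h | h | h | h
        · exact Or.inl ⟨clean_of_not_badRound hp hδ hl.le hx.1 hi hgood (not_lt.1 hc), h⟩
        · exact Or.inr (Or.inl h)
        · exact Or.inr (Or.inr (Or.inl h))
        · exact Or.inr (Or.inr (Or.inr h))
    -- The weight costs 2e: one e from the cubic exponential at v = (lam - δ)s, one from the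
    -- exceptional rows with too many small entries.
    _ ≤ ENNReal.ofReal (2 * e) + (ENNReal.ofReal e + (ENNReal.ofReal e + ENNReal.ofReal e)) :=
        (measure_union_le _ _).trans (add_le_add hv ((measure_union_le _ _).trans
          (add_le_add hsm1 ((measure_union_le _ _).trans (add_le_add hsm2 hch)))))
    _ = ENNReal.ofReal (5 * e) := by
        rw [← ENNReal.ofReal_add he he, ← ENNReal.ofReal_add he (by linarith),
          ← ENNReal.ofReal_add (by linarith) (by linarith)]
        congr 1; ring

/-- Splitting by the first bad round supplies the good history required by
`dataMeasure_badRound_le`. -/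
lemma dataMeasure_exists_badRound_le (hp : IsTieBreak pick) {δ lam e : ℝ} (hδ : 0 < δ) (hδ1 : δ ≤ 1)
    (hl : δ < lam) {i : Fin n} (hi : ∀ l ≤ i, AdmissibleScale n (n - l) δ lam e) :
    dataMeasure n {x | ∃ l ≤ i, BadRound pick δ lam x l} ≤ ENNReal.ofReal (n * (5 * e)) := by
  classical
  calc _ ≤ dataMeasure n (⋃ l ∈ Finset.univ.filter (· ≤ i),
          {x | BadRound pick δ lam x l ∧ ∀ l' < l, ¬ BadRound pick δ lam x l'}) := by
        refine measure_mono ?_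
        rintro x ⟨l, hli, hbad⟩
        have hne : (Finset.univ.filter fun l => BadRound pick δ lam x l).Nonempty :=
          ⟨l, by simpa using hbad⟩
        have hmem := (Finset.mem_filter.1 (Finset.min'_mem _ hne)).2
        have hmin := Finset.min'_le (Finset.univ.filter fun l => BadRound pick δ lam x l)
        simp only [Set.mem_iUnion]
        refine ⟨Finset.min' _ hne, ?_, hmem, fun l' hl' hbad' => ?_⟩
        · simp only [Finset.mem_filter, Finset.mem_univ, true_and]
          exact (hmin l (by simpa using hbad)).trans hli
        · exact absurd (hmin l' (by simpa using hbad')) (not_le.2 hl')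
    _ ≤ ∑ l ∈ Finset.univ.filter (· ≤ i),
          dataMeasure n {x | BadRound pick δ lam x l ∧ ∀ l' < l, ¬ BadRound pick δ lam x l'} :=
        measure_biUnion_finset_le _ _
    _ ≤ ∑ l ∈ Finset.univ.filter (· ≤ i), ENNReal.ofReal (5 * e) :=
        Finset.sum_le_sum fun l hl' =>
          dataMeasure_badRound_le hp hδ hδ1 hl (hi l (Finset.mem_filter.1 hl').2)
    _ ≤ _ := by
        have he : 0 ≤ e := (Real.exp_nonneg _).trans (hi i le_rfl).exp_count_le
        rw [Finset.sum_const, nsmul_eq_mul, ENNReal.ofReal_mul (Nat.cast_nonneg _),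
          ENNReal.ofReal_natCast]
        gcongr
        exact (Finset.card_le_univ _).trans (Fintype.card_fin n).le

/-- Tail bound for the weight of round `i`. -/
lemma roundWeight_tail_le (hp : IsTieBreak pick) {δ lam e v : ℝ} (hδ : 0 < δ) (hδ1 : δ ≤ 1)
    (hl : δ < lam) {i : Fin n} (hi : ∀ l ≤ i, AdmissibleScale n (n - l) δ lam e) (hv0 : 0 < v)
    (hv : v ≤ lam * weightScale (n - i)) :
    (dataMeasure n).real {x | δ * weightScale (n - i) + v < roundWeight pick x i} ≤
      Real.exp (-((1 - δ) ^ 3 * ((n - i : ℕ) : ℝ) ^ 2 * v ^ 3 / 6)) + (e + n * (5 * e)) := by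
  have he : 0 ≤ e := (Real.exp_nonneg _).trans (hi i le_rfl).exp_count_le
  refine ENNReal.toReal_le_of_le_ofReal (by positivity) ?_
  rw [← add_assoc, ENNReal.ofReal_add (by positivity) (by positivity)]
  refine le_trans ?_ (add_le_add (roundWeight_tail_of_clean hp hδ hδ1 hl (hi i le_rfl) hv0 hv)
    (dataMeasure_exists_badRound_le hp hδ hδ1 hl hi))
  refine le_trans (measure_mono_ae ?_) (measure_union_le _ _)
  filter_upwards [ae_dataMeasure_mem_Icc] with x hx
  intro hw
  by_cases hb : ∃ l ≤ i, BadRound pick δ lam x l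
  · exact Or.inr hb
  · push Not at hb
    refine Or.inl ⟨clean_of_not_badRound hp hδ hl.le hx.1 (hi i le_rfl)
      (fun l hli => hb l hli.le) ?_, hw⟩
    have := hb i le_rfl
    simp only [BadRound, not_or, not_lt] at this
    exact this.2.2.2

/-! ### Transfer from the given random variables to the product measure -/

section Transfer

lemma map_eq_unitUniform {Ω : Type*} [MeasurableSpace Ω] {P : Measure Ω} {X : Ω → ℝ}
    (h : pdf.IsUniform X (Set.Icc 0 1) P volume) : P.map X = unitUniform := by
  rw [pdf.IsUniform] at h
  rw [h, unitUniform, ProbabilityTheory.cond]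
  simp

/-- The index set of the `3 n ^ 2` random variables. -/
abbrev CostIndex (n : ℕ) : Type := (Fin n × Fin n) ⊕ ((Fin n × Fin n) ⊕ (Fin n × Fin n))

def flattenData (x : CostData n) : CostIndex n → ℝ :=
  Sum.elim (fun p => (x.1 p.1).1 p.2) (Sum.elim (fun p => (x.1 p.1).2 p.2) x.2)

def bundleData (y : CostIndex n → ℝ) : CostData n :=
  (fun i => (fun j => y (Sum.inl (i, j)), fun k => y (Sum.inr (Sum.inl (i, k)))),
    fun p => y (Sum.inr (Sum.inr p)))

lemma measurable_flattenData : Measurable (flattenData : CostData n → CostIndex n → ℝ) := by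
  refine measurable_pi_lambda _ fun d => ?_
  rcases d with p | p | p <;> simp only [flattenData, Sum.elim_inl, Sum.elim_inr] <;> fun_prop

lemma measurable_bundleData : Measurable (bundleData : (CostIndex n → ℝ) → CostData n) := by
  unfold bundleData
  fun_prop

lemma map_flattenData :
    (dataMeasure n).map flattenData = Measure.pi fun _ : CostIndex n => unitUniform := by
  symm
  refine Measure.pi_eq fun s hs => ?_
  rw [Measure.map_apply measurable_flattenData (MeasurableSet.univ_pi hs)]
  have : (flattenData : CostData n → CostIndex n → ℝ) ⁻¹' (Set.univ.pi s) =
      (Set.univ.pi fun i => (Set.univ.pi fun j => s (Sum.inl (i, j))) ×ˢ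
        (Set.univ.pi fun k => s (Sum.inr (Sum.inl (i, k))))) ×ˢ
      (Set.univ.pi fun p => s (Sum.inr (Sum.inr p))) := by
    ext x
    simp only [Set.mem_preimage, Set.mem_pi, Set.mem_univ, true_imp_iff, Set.mem_prod,
      Sum.forall, flattenData, Sum.elim_inl, Sum.elim_inr, Prod.forall]
    constructor
    · rintro ⟨h1, h2, h3⟩; exact ⟨fun i => ⟨h1 i, h2 i⟩, h3⟩
    · rintro ⟨h1, h3⟩; exact ⟨fun i => (h1 i).1, fun i => (h1 i).2, h3⟩
  rw [this, dataMeasure, Measure.prod_prod, Measure.pi_pi, Measure.pi_pi]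
  simp only [rowMeasure, Measure.prod_prod, Measure.pi_pi]
  rw [Fintype.prod_sum_type, Fintype.prod_sum_type, Finset.prod_mul_distrib,
    Fintype.prod_prod_type, Fintype.prod_prod_type, Fintype.prod_prod_type, mul_assoc]

lemma map_bundleData :
    (Measure.pi fun _ : CostIndex n => unitUniform).map bundleData = dataMeasure n := by
  rw [← map_flattenData, Measure.map_map measurable_bundleData measurable_flattenData]
  have : (bundleData ∘ flattenData : CostData n → CostData n) = id := rfl
  rw [this, Measure.map_id]

/-- The random cost data has law `dataMeasure`. -/
lemma IsIIDUniform.map_data {Ω : Type*} [MeasurableSpace Ω] {P : Measure Ω}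
    [IsProbabilityMeasure P] {a b c : Fin n → Fin n → Ω → ℝ} (h : IsIIDUniform a b c P) :
    Measurable (fun ω => ((fun i => (fun j => a i j ω, fun k => b i k ω),
        fun p => c p.1 p.2 ω) : CostData n)) ∧
      P.map (fun ω => ((fun i => (fun j => a i j ω, fun k => b i k ω),
        fun p => c p.1 p.2 ω) : CostData n)) = dataMeasure n := by
  set f : CostIndex n → Ω → ℝ := Sum.elim (fun p : Fin n × Fin n => a p.1 p.2)
      (Sum.elim (fun p : Fin n × Fin n => b p.1 p.2) (fun p : Fin n × Fin n => c p.1 p.2)) with hf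
  have hm : ∀ d, Measurable (f d) := by
    rintro (p | p | p)
    · exact h.measurable_a _ _
    · exact h.measurable_b _ _
    · exact h.measurable_c _ _
  have hlaw : ∀ d, P.map (f d) = unitUniform := by
    rintro (p | p | p)
    · exact map_eq_unitUniform (h.uniform_a _ _)
    · exact map_eq_unitUniform (h.uniform_b _ _)
    · exact map_eq_unitUniform (h.uniform_c _ _)
  have hpi := (iIndepFun_iff_map_fun_eq_pi_map fun d => (hm d).aemeasurable).1 h.indep
  have hmf : Measurable fun ω d => f d ω := measurable_pi_lambda _ hm
  have hcomp : (fun ω => ((fun i => (fun j => a i j ω, fun k => b i k ω),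
        fun p => c p.1 p.2 ω) : CostData n)) = bundleData ∘ fun ω d => f d ω := rfl
  rw [hcomp]
  refine ⟨measurable_bundleData.comp hmf, ?_⟩
  rw [← Measure.map_map measurable_bundleData hmf]
  have hpi' : P.map (fun ω d => f d ω) = Measure.pi fun _ : CostIndex n => unitUniform := by
    rw [hpi]; simp only [hlaw]
  rw [hpi', map_bundleData]

end Transfer

/-! ### From tails to expectations -/

lemma ae_roundWeight_mem_Icc (i : Fin n) :
    ∀ᵐ x ∂dataMeasure n, roundWeight pick x i ∈ Set.Icc (0 : ℝ) 3 := by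
  filter_upwards [ae_dataMeasure_mem_Icc] with x hx
  rw [roundWeight, greedyWeight, dataCost_apply]
  have h1 := (hx.1 i (greedyPair (dataCost x) pick i).1).1
  have h2 := (hx.1 i (greedyPair (dataCost x) pick i).2).2
  have h3 := hx.2 (greedyPair (dataCost x) pick i)
  simp only [Prod.mk.eta, Set.mem_Icc] at *
  constructor <;> linarith

lemma integrable_roundWeight (i : Fin n) :
    Integrable (fun x => roundWeight pick x i) (dataMeasure n) := by
  refine Integrable.of_bound (measurable_roundWeight i).aestronglyMeasurable 3 ?_
  filter_upwards [ae_roundWeight_mem_Icc i] with x hx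
  rw [Real.norm_eq_abs, abs_of_nonneg hx.1]
  exact hx.2

lemma integral_exp_neg_mul_cube {κ : ℝ} (hκ : 0 < κ) :
    ∫ v in Set.Ioi (0 : ℝ), Real.exp (-(κ * v ^ 3)) = κ ^ (-(1 / 3) : ℝ) * Real.Gamma (4 / 3) := by
  have h := integral_exp_neg_mul_rpow (p := 3) (b := κ) (by norm_num) hκ
  norm_num at h ⊢
  rw [← h]

lemma integrableOn_exp_neg_mul_cube {κ : ℝ} (hκ : 0 < κ) :
    IntegrableOn (fun v : ℝ => Real.exp (-(κ * v ^ 3))) (Set.Ioi 0) := by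
  -- A non-integrable function has integral 0 by convention, so a positive value of the integral
  -- proves integrability.
  refine not_imp_comm.1 integral_undef ?_
  rw [integral_exp_neg_mul_cube hκ]
  have := Real.Gamma_pos_of_pos (s := 4 / 3) (by norm_num)
  positivity

/-- A random variable with values in `[0, 3]` and a cubic exponential tail up to a shift `τ` and
an error `η` has mean at most the integral of that tail bound. -/
lemma integral_le_of_cubic_tail {Ω : Type*} [MeasurableSpace Ω] {μ : Measure Ω}
    [IsProbabilityMeasure μ] {W : Ω → ℝ} (hWi : Integrable W μ)
    (hW : ∀ᵐ x ∂μ, W x ∈ Set.Icc (0 : ℝ) 3) {τ κ η : ℝ} (hτ : 0 ≤ τ) (hκ : 0 < κ) (hη : 0 ≤ η)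
    (htail : ∀ w, τ < w → w ≤ 3 → μ.real {x | w < W x} ≤ Real.exp (-(κ * (w - τ) ^ 3)) + η) :
    ∫ x, W x ∂μ ≤ τ + κ ^ (-(1 / 3) : ℝ) * Real.Gamma (4 / 3) + 3 * η := by
  set h : ℝ → ℝ := (Set.Ioi (0 : ℝ)).indicator fun v => Real.exp (-(κ * v ^ 3)) with hh
  -- Majorant of the tail for the layer-cake formula: 1 up to τ, then the shifted cubic tail, plus η
  -- on (0, 3]. Beyond 3 the tail vanishes.
  set g : ℝ → ℝ := fun w => (Set.Ioc 0 τ).indicator (fun _ => 1) w + h (w - τ) +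
    (Set.Ioc (0 : ℝ) 3).indicator (fun _ => η) w with hg
  have hhi : Integrable h :=
    (integrable_indicator_iff measurableSet_Ioi).2 (integrableOn_exp_neg_mul_cube hκ)
  have hi1 : Integrable ((Set.Ioc 0 τ).indicator fun _ : ℝ => (1 : ℝ)) :=
    (integrable_indicator_iff measurableSet_Ioc).2 (integrableOn_const (by simp))
  have hi2 : Integrable fun w => h (w - τ) := hhi.comp_sub_right τ
  have hi3 : Integrable ((Set.Ioc (0 : ℝ) 3).indicator fun _ : ℝ => η) :=
    (integrable_indicator_iff measurableSet_Ioc).2 (integrableOn_const (by simp))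
  have hgi : Integrable g := (hi1.add hi2).add hi3
  have hh0 : ∀ v, 0 ≤ h v := fun v => Set.indicator_nonneg (fun _ _ => (Real.exp_pos _).le) v
  have hg0 : ∀ w, 0 ≤ g w := fun w => add_nonneg (add_nonneg
    (Set.indicator_nonneg (fun _ _ => zero_le_one) w) (hh0 _))
    (Set.indicator_nonneg (fun _ _ => hη) w)
  have hle : ∀ w ∈ Set.Ioi (0 : ℝ), μ.real {x | w < W x} ≤ g w := by
    intro w hw
    have hw0 : 0 < w := hw
    by_cases hwτ : w ≤ τ
    · have h1 : (Set.Ioc 0 τ).indicator (fun _ => (1 : ℝ)) w = 1 :=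
        Set.indicator_of_mem (s := Set.Ioc 0 τ) ⟨hw0, hwτ⟩ _
      have h2 := hh0 (w - τ)
      have h3 : 0 ≤ (Set.Ioc (0 : ℝ) 3).indicator (fun _ => η) w :=
        Set.indicator_nonneg (fun _ _ => hη) w
      have h4 : μ.real {x | w < W x} ≤ 1 := measureReal_le_one
      simp only [hg]
      linarith
    by_cases hw3 : w ≤ 3
    · have h1 : 0 ≤ (Set.Ioc 0 τ).indicator (fun _ => (1 : ℝ)) w :=
        Set.indicator_nonneg (fun _ _ => zero_le_one) w
      have h2 : h (w - τ) = Real.exp (-(κ * (w - τ) ^ 3)) :=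
        Set.indicator_of_mem (by simp only [Set.mem_Ioi]; linarith) _
      have h3 : (Set.Ioc (0 : ℝ) 3).indicator (fun _ => η) w = η :=
        Set.indicator_of_mem (s := Set.Ioc (0 : ℝ) 3) ⟨hw0, hw3⟩ _
      have h4 := htail w (not_le.1 hwτ) hw3
      simp only [hg]
      linarith
    · have : μ {x | w < W x} = 0 := by
        refine measure_mono_null (t := {x | ¬ W x ∈ Set.Icc (0 : ℝ) 3}) (fun x hx hx' => ?_)
          (ae_iff.1 hW)
        exact hw3 ((le_of_lt hx).trans hx'.2)
      rw [measureReal_def, this, ENNReal.toReal_zero]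
      exact hg0 w
  rw [hWi.integral_eq_integral_meas_lt (hW.mono fun x hx => hx.1)]
  calc ∫ w in Set.Ioi (0 : ℝ), μ.real {x | w < W x}
      ≤ ∫ w in Set.Ioi (0 : ℝ), g w :=
        integral_mono_of_nonneg (Filter.Eventually.of_forall fun w => measureReal_nonneg)
          hgi.integrableOn ((ae_restrict_iff' measurableSet_Ioi).2
            (Filter.Eventually.of_forall hle))
    _ ≤ ∫ w, g w := setIntegral_le_integral hgi (Filter.Eventually.of_forall hg0)
    _ = τ + (∫ v, h v) + 3 * η := by
        have e1 : ∫ w, g w = (∫ w, ((Set.Ioc 0 τ).indicator (fun _ => (1 : ℝ)) w + h (w - τ))) +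
            ∫ w, (Set.Ioc (0 : ℝ) 3).indicator (fun _ => η) w := integral_add (hi1.add hi2) hi3
        rw [e1, integral_add hi1 hi2, integral_sub_right_eq_self h τ,
          integral_indicator_const _ measurableSet_Ioc, integral_indicator_const _ measurableSet_Ioc]
        simp [measureReal_def, hτ]
    _ = _ := by
        rw [hh, integral_indicator measurableSet_Ioi, integral_exp_neg_mul_cube hκ]

lemma integral_roundWeight_le (hp : IsTieBreak pick) {δ lam e : ℝ} (hδ : 0 < δ) (hδ1 : δ < 1)
    (hl : δ < lam) {i : Fin n} (hi : ∀ l ≤ i, AdmissibleScale n (n - l) δ lam e) :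
    ∫ x, roundWeight pick x i ∂dataMeasure n ≤
      (δ + (1 - δ)⁻¹ * greedyConst) * weightScale (n - i) + 3 * (2 * e + n * (5 * e)) := by
  have he : 0 ≤ e := (Real.exp_nonneg _).trans (hi i le_rfl).exp_count_le
  have hr : 0 < n - (i : ℕ) := by have := i.2; omega
  have hi0 := hi i le_rfl
  have htail := fun v => roundWeight_tail_le (v := v) hp hδ hδ1.le hl hi
  obtain ⟨r, hrdef⟩ : ∃ r : ℕ, r = n - (i : ℕ) := ⟨_, rfl⟩
  rw [← hrdef] at hr hi0 htail ⊢
  have hs := weightScale_pos hr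
  have hr' : (0 : ℝ) < r := by exact_mod_cast hr
  set s := weightScale r with hsdef
  have h1δ : 0 < 1 - δ := by linarith
  have hκ : 0 < (1 - δ) ^ 3 * (r : ℝ) ^ 2 / 6 := by positivity
  refine (integral_le_of_cubic_tail (integrable_roundWeight i) (ae_roundWeight_mem_Icc i)
    (τ := δ * s) (κ := (1 - δ) ^ 3 * (r : ℝ) ^ 2 / 6) (η := 2 * e + n * (5 * e)) (by positivity) hκ
    (by positivity) ?_).trans (le_of_eq ?_)
  · intro w hw _
    by_cases hwl : w ≤ lam * s
    · have h := htail (w - δ * s) (by linarith) (by nlinarith)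
      rw [add_sub_cancel] at h
      refine h.trans ?_
      have h2 : (1 - δ) ^ 3 * (r : ℝ) ^ 2 * (w - δ * s) ^ 3 / 6 =
        (1 - δ) ^ 3 * (r : ℝ) ^ 2 / 6 * (w - δ * s) ^ 3 := by ring
      rw [h2]
      linarith
    -- The tail bound stops at w = lam · s; beyond it monotonicity is used. There the exponential is
    -- at most e, which is the second e in η.
    · have h := htail ((lam - δ) * s) (mul_pos (by linarith) hs) (by nlinarith)
      have h2 : δ * s + (lam - δ) * s = lam * s := by ring
      rw [h2] at h
      have h3 : (dataMeasure n).real {x | w < roundWeight pick x i} ≤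
          (dataMeasure n).real {x | lam * s < roundWeight pick x i} :=
        measureReal_mono fun x hx => lt_trans (not_le.1 hwl) hx
      have h4 := hi0.exp_cube_le
      have h5 := Real.exp_pos (-((1 - δ) ^ 3 * (r : ℝ) ^ 2 / 6 * (w - δ * s) ^ 3))
      linarith
  · have h1 : ((1 - δ) ^ 3 * (r : ℝ) ^ 2 / 6) ^ (-(1 / 3) : ℝ) =
        (1 - δ)⁻¹ * s * 6 ^ (1 / 3 : ℝ) := by
      rw [Real.div_rpow (by positivity) (by norm_num), Real.mul_rpow (by positivity) (by positivity),
        ← Real.rpow_natCast, ← Real.rpow_natCast, ← Real.rpow_mul h1δ.le, ← Real.rpow_mul hr'.le,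
        Real.rpow_neg (by norm_num : (0 : ℝ) ≤ 6), div_inv_eq_mul, hsdef, weightScale]
      congr 2
      · norm_num [Real.rpow_neg_one]
      · norm_num
    rw [h1, greedyConst]
    ring

/-! ### Choice of parameters -/

/-- In terms of t = r^(1/3) the scale is t^(-2), and every condition compares powers of t and `lam`.
The 48 = 6 · 2³ comes from lam - δ ≥ lam/2 in `exp_cube_le`; the bound 128 lam⁸ / δ⁷ is exactly
`near_le`, and the other lower bounds on t follow from it. -/
lemma admissibleScale_of_le {n r : ℕ} {δ lam t : ℝ} (hn : (n : ℝ) = Real.exp lam)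
    (hδ : 0 < δ) (hδ1 : δ < 1) (hlam : 48 / (1 - δ) ^ 3 ≤ lam) (ht : 128 / δ ^ 7 * lam ^ 8 ≤ t)
    (hrt : (r : ℝ) = t ^ 3) :
    AdmissibleScale n r δ lam (Real.exp (-lam ^ 2)) := by
  have h1δ : 0 < 1 - δ := by linarith
  have hlam48 : 48 ≤ lam := by
    refine le_trans ?_ hlam
    rw [le_div_iff₀ (by positivity)]
    have : (1 - δ) ^ 3 ≤ 1 := pow_le_one₀ h1δ.le (by linarith)
    linarith
  have hl1 : 1 ≤ lam := by linarith
  have hl0 : 0 < lam := by linarith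
  have hδt : 128 * lam ^ 8 ≤ t * δ ^ 7 := by
    rwa [div_mul_eq_mul_div, div_le_iff₀ (by positivity)] at ht
  have hl8 : lam ^ 2 ≤ lam ^ 8 := pow_le_pow_right₀ hl1 (by norm_num)
  have ht0 : 0 < t := lt_of_lt_of_le (by positivity) ht
  have hδ7 : δ ^ 7 ≤ δ := by
    calc δ ^ 7 ≤ δ ^ 1 := pow_le_pow_of_le_one hδ.le hδ1.le (by norm_num)
      _ = δ := pow_one δ
  have htδ : 128 * lam ^ 2 ≤ t * δ := by nlinarith
  have htl : 128 * lam ^ 2 ≤ t := by nlinarith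
  have hll : lam ≤ lam ^ 2 := by nlinarith
  have hs : weightScale r = (t ^ 2)⁻¹ := by
    rw [weightScale, hrt, ← Real.rpow_natCast, ← Real.rpow_mul ht0.le, ← Real.rpow_natCast,
      ← Real.rpow_neg ht0.le]
    norm_num
  have ht1 : 1 ≤ t := by nlinarith
  refine ⟨?_, ?_, ?_, ?_, ?_, ?_, ?_⟩ <;> rw [hs] <;> (try rw [hrt])
  · rw [← div_eq_mul_inv, div_le_one (by positivity)]
    nlinarith
  · have : t ^ 3 * (lam * (t ^ 2)⁻¹) ^ 2 = lam ^ 2 / t := by field_simp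
    rw [this, div_le_iff₀ ht0]
    nlinarith
  · refine Real.exp_le_exp.2 (neg_le_neg ?_)
    have : (1 - δ) ^ 3 * (t ^ 3) ^ 2 * ((lam - δ) * (t ^ 2)⁻¹) ^ 3 / 6 =
      (1 - δ) ^ 3 * (lam - δ) ^ 3 / 6 := by field_simp
    rw [this]
    rw [div_le_iff₀ (by positivity)] at hlam
    have h2 : (lam / 2) ^ 3 ≤ (lam - δ) ^ 3 := pow_le_pow_left₀ (by linarith) (by linarith) 3
    have h3 : (1 - δ) ^ 3 * (lam / 2) ^ 3 ≤ (1 - δ) ^ 3 * (lam - δ) ^ 3 :=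
      mul_le_mul_of_nonneg_left h2 (by positivity)
    have h4 : 48 * lam ^ 2 ≤ lam * (1 - δ) ^ 3 * lam ^ 2 :=
      mul_le_mul_of_nonneg_right hlam (by positivity)
    nlinarith
  · refine Real.exp_le_exp.2 ?_
    have : 2 * t ^ 3 * (lam * (t ^ 2)⁻¹) - δ / (lam * (t ^ 2)⁻¹) =
      2 * t * lam - t * (t * δ / lam) := by field_simp
    rw [this]
    have h2 : 128 * lam ≤ t * δ / lam := by
      rw [le_div_iff₀ hl0]; nlinarith
    have h3 : t * (128 * lam) ≤ t * (t * δ / lam) := mul_le_mul_of_nonneg_left h2 ht0.le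
    have h4 : lam * lam ≤ t * lam := mul_le_mul_of_nonneg_right (by linarith) hl0.le
    nlinarith
  · refine Real.exp_le_exp.2 (neg_le_neg ?_)
    have : 6 * (lam * (t ^ 2)⁻¹) * t ^ 3 = 6 * (t * lam) := by field_simp
    rw [this]
    have h4 : lam * lam ≤ t * lam := mul_le_mul_of_nonneg_right (by linarith) hl0.le
    nlinarith
  · rw [hn, ← Real.exp_nat_mul, ← Real.exp_nat_mul, ← Real.exp_add, hrt]
    refine Real.exp_le_exp.2 ?_
    have : 2 * (δ * (t ^ 2)⁻¹) * (t ^ 3) ^ 2 = 2 * δ * t ^ 4 := by field_simp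
    rw [this]
    have e1 : 128 * t ≤ t ^ 2 := by nlinarith
    have h1 : δ * t ^ 4 * 128 ≤ δ * t ^ 4 * t ^ 2 :=
      mul_le_mul_of_nonneg_left (by nlinarith) (by positivity)
    have e2 : 1 ≤ t ^ 2 := one_le_pow₀ ht1
    have e5 : 1 ≤ t ^ 5 := one_le_pow₀ ht1
    have h2 : t ^ 3 * (128 * lam ^ 2) ≤ t ^ 3 * (t * δ) :=
      mul_le_mul_of_nonneg_left htδ (by positivity)
    have h2' : t ^ 3 * lam ≤ t ^ 3 * lam ^ 2 := mul_le_mul_of_nonneg_left hll (by positivity)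
    have h3 : δ * t ^ 4 * 1 ≤ δ * t ^ 4 * t ^ 2 :=
      mul_le_mul_of_nonneg_left e2 (by positivity)
    have h5 : t * δ * 1 ≤ t * δ * t ^ 5 := mul_le_mul_of_nonneg_left e5 (by positivity)
    push_cast
    nlinarith
  · have : 64 * (lam / δ) ^ 6 * lam ^ 2 * (t ^ 2)⁻¹ ^ 2 * t ^ 3 =
      64 * lam ^ 8 / (δ ^ 6 * t) := by field_simp
    rw [this, div_le_iff₀ (by positivity)]
    nlinarith

open Filter Asymptotics in
lemma eventually_scale_conditions {δ : ℝ} (hδ : 0 < δ) :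
    ∀ᶠ n : ℕ in atTop, 48 / (1 - δ) ^ 3 ≤ Real.log n ∧ 3 ≤ Real.log n ∧ 21 / δ ≤ (n : ℝ) ∧
      128 / δ ^ 7 * Real.log n ^ 8 ≤ (n : ℝ) ^ (1 / 12 : ℝ) := by
  have hcast : Tendsto (fun n : ℕ => (n : ℝ)) atTop atTop := tendsto_natCast_atTop_atTop
  have hlog := Real.tendsto_log_atTop.comp hcast
  have ho := (isLittleO_log_rpow_rpow_atTop 8 (by norm_num : (0 : ℝ) < 1 / 12)).bound
    (by positivity : 0 < δ ^ 7 / 128)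
  filter_upwards [hlog.eventually_ge_atTop (48 / (1 - δ) ^ 3), hlog.eventually_ge_atTop 3,
    hcast.eventually_ge_atTop (21 / δ), hcast.eventually ho] with n h1 h2 h3 h4
  refine ⟨h1, h2, h3, ?_⟩
  simp only [Function.comp] at h2
  rw [Real.norm_of_nonneg (by positivity), Real.norm_of_nonneg (by positivity)] at h4
  have h5 : Real.log n ^ (8 : ℝ) = Real.log n ^ 8 := by
    rw [← Real.rpow_natCast]; norm_num
  rw [h5] at h4
  calc 128 / δ ^ 7 * Real.log n ^ 8 ≤ 128 / δ ^ 7 * (δ ^ 7 / 128 * (n : ℝ) ^ (1 / 12 : ℝ)) := by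
        gcongr
    _ = _ := by field_simp

lemma greedyConst_pos : 0 < greedyConst := by
  have := Real.Gamma_pos_of_pos (s := 4 / 3) (by norm_num)
  unfold greedyConst
  positivity

open Filter Topology in
-- At δ = 0 the left side is `greedyConst`, strictly below the right side, so continuity suffices.
-- The last δ is reserved for the failure probabilities.
lemma exists_small_parameter {ε : ℝ} (hε : 0 < ε) :
    ∃ δ : ℝ, 0 < δ ∧ δ < 1 ∧ δ + (1 - δ)⁻¹ * greedyConst + δ ≤ (1 + ε) * greedyConst := by
  have hc : ContinuousAt (fun δ : ℝ => δ + (1 - δ)⁻¹ * greedyConst + δ) 0 := by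
    refine ((continuousAt_id.add (((continuousAt_const.sub continuousAt_id).inv₀
      (by simp)).mul continuousAt_const)).add continuousAt_id)
  have hlt : (fun δ : ℝ => δ + (1 - δ)⁻¹ * greedyConst + δ) 0 < (1 + ε) * greedyConst := by
    simp only [zero_add, sub_zero, inv_one, one_mul, add_zero]
    nlinarith [greedyConst_pos]
  have h1 : ∀ᶠ δ in 𝓝[>] (0 : ℝ), δ + (1 - δ)⁻¹ * greedyConst + δ < (1 + ε) * greedyConst :=
    (hc.eventually_lt_const hlt).filter_mono nhdsWithin_le_nhds
  have h2 : ∀ᶠ δ in 𝓝[>] (0 : ℝ), δ < 1 :=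
    (eventually_lt_nhds zero_lt_one).filter_mono nhdsWithin_le_nhds
  obtain ⟨δ, h3, h4, h5⟩ := (h1.and (h2.and self_mem_nhdsWithin)).exists
  exact ⟨δ, h5, h4, h3.le⟩

/-- From log n ≥ 3 one gets exp(-(log n)²) ≤ n^(-3), while the scale is at least 1/n. The 21 is 3 ·
(2 + 5). -/
lemma error_le_weightScale {n r : ℕ} {δ : ℝ} (hr : 0 < r) (hrn : r ≤ n)
    (hl3 : 3 ≤ Real.log n) (hnδ : 21 / δ ≤ n) (hδ : 0 < δ) :
    3 * (2 * Real.exp (-Real.log n ^ 2) + n * (5 * Real.exp (-Real.log n ^ 2))) ≤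
      δ * weightScale r := by
  have hn1 : (1 : ℝ) ≤ n := by exact_mod_cast hr.trans_le hrn
  have hn0 : (0 : ℝ) < n := by linarith
  have he : Real.exp (-Real.log n ^ 2) ≤ ((n : ℝ) ^ 3)⁻¹ := by
    rw [← Real.exp_log (pow_pos hn0 3), ← Real.exp_neg, Real.log_pow]
    refine Real.exp_le_exp.2 (neg_le_neg ?_)
    push_cast
    nlinarith
  have hs : (n : ℝ)⁻¹ ≤ weightScale r := by
    refine le_trans ?_ (weightScale_anti hr hrn)
    rw [weightScale, ← Real.rpow_neg_one]
    exact Real.rpow_le_rpow_of_exponent_le hn1 (by norm_num)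
  rw [div_le_iff₀ hδ] at hnδ
  calc _ ≤ 3 * (2 * ((n : ℝ) ^ 3)⁻¹ + n * (5 * ((n : ℝ) ^ 3)⁻¹)) := by gcongr
    _ ≤ 21 * n * ((n : ℝ) ^ 3)⁻¹ := by
        have : 0 ≤ ((n : ℝ) ^ 3)⁻¹ := by positivity
        nlinarith
    _ = 21 * ((n : ℝ)⁻¹ * (n : ℝ)⁻¹) := by field_simp
    _ ≤ n * δ * ((n : ℝ)⁻¹ * (n : ℝ)⁻¹) := by gcongr
    _ = δ * (n : ℝ)⁻¹ := by field_simp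
    _ ≤ _ := by gcongr

end

theorem lemma2 :
    ∀ ε : ℝ, 0 < ε → ∃ N : ℕ, ∀ n : ℕ, N ≤ n →
      ∀ (Ω : Type*) [MeasurableSpace Ω] (P : Measure Ω) [IsProbabilityMeasure P]
        (a b c : Fin n → Fin n → Ω → ℝ), IsIIDUniform a b c P →
      ∀ pick : Finset (Fin n × Fin n) → Fin n × Fin n, IsTieBreak pick →
      ∀ (m : ℕ) (i : Fin n), m = (i : ℕ) + 1 → (m : ℝ) ≤ (n : ℝ) - (n : ℝ) ^ (1 / 4 : ℝ) →
        Integrable (randomGreedyWeight a b c pick i) P ∧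
        ∫ ω, randomGreedyWeight a b c pick i ω ∂P
          ≤ (1 + ε) * greedyConst * ((n : ℝ) - (m : ℝ) + 1) ^ (-(2 / 3) : ℝ) := by
  intro ε hε
  obtain ⟨δ, hδ0, hδ1, hδ⟩ := exists_small_parameter hε
  obtain ⟨N, hN⟩ := Filter.eventually_atTop.1 (eventually_scale_conditions hδ0)
  refine ⟨N, fun n hn Ω _ P _ a b c hiid pick hp m i hm hmn => ?_⟩
  obtain ⟨h48, hl3, hnδ, hpoly⟩ := hN n hn
  obtain ⟨hX, hlaw⟩ := hiid.map_data
  have hn0 : (0 : ℝ) < n := by exact_mod_cast i.pos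
  have hcomp : randomGreedyWeight a b c pick i =
      (fun x => roundWeight pick x i) ∘ fun ω =>
        ((fun i => (fun j => a i j ω, fun k => b i k ω), fun p => c p.1 p.2 ω) : CostData n) := rfl
  have hmeas := measurable_roundWeight (pick := pick) i
  have hcast : ((n - (i : ℕ) : ℕ) : ℝ) = (n : ℝ) - m + 1 := by
    rw [Nat.cast_sub i.2.le, hm]; push_cast; ring
  have hadm : ∀ l ≤ i, AdmissibleScale n (n - l) δ (Real.log n)
      (Real.exp (-Real.log n ^ 2)) := by
    intro l hl
    -- Here n - i = n - m + 1, so the assumption on m leaves at least n^(1/4) indices in round i,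
    -- and no fewer in earlier rounds.
    have hr : (n : ℝ) ^ (1 / 4 : ℝ) ≤ ((n - (l : ℕ) : ℕ) : ℝ) := by
      have h1 : n - (i : ℕ) ≤ n - (l : ℕ) := Nat.sub_le_sub_left (Fin.le_def.1 hl) n
      have h2 : ((n - (i : ℕ) : ℕ) : ℝ) ≤ ((n - (l : ℕ) : ℕ) : ℝ) := Nat.cast_le.2 h1
      linarith
    -- With lam = log n, the cube root of the number of remaining indices is at least n^(1/12),
    -- which dominates the required multiple of (log n)⁸.
    refine admissibleScale_of_le (t := ((n - (l : ℕ) : ℕ) : ℝ) ^ (1 / 3 : ℝ))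
      (Real.exp_log hn0).symm hδ0 hδ1 h48 (hpoly.trans ?_) ?_
    · calc (n : ℝ) ^ (1 / 12 : ℝ) = ((n : ℝ) ^ (1 / 4 : ℝ)) ^ (1 / 3 : ℝ) := by
            rw [← Real.rpow_mul hn0.le]; norm_num
        _ ≤ _ := Real.rpow_le_rpow (by positivity) hr (by norm_num)
    · rw [← Real.rpow_natCast, ← Real.rpow_mul (Nat.cast_nonneg _)]
      norm_num
  refine ⟨?_, ?_⟩
  · rw [hcomp]
    refine Integrable.comp_measurable ?_ hX
    rw [hlaw]
    exact integrable_roundWeight i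
  · have hint : ∫ ω, randomGreedyWeight a b c pick i ω ∂P =
        ∫ x, roundWeight pick x i ∂dataMeasure n := by
      rw [← hlaw, integral_map hX.aemeasurable hmeas.aestronglyMeasurable]
      rfl
    have hδl : δ < Real.log n := by linarith
    have hr : 0 < n - (i : ℕ) := Nat.sub_pos_of_lt i.2
    have hs := weightScale_pos hr
    calc ∫ ω, randomGreedyWeight a b c pick i ω ∂P
        ≤ (δ + (1 - δ)⁻¹ * greedyConst) * weightScale (n - i) + δ * weightScale (n - i) := by
          rw [hint]
          exact (integral_roundWeight_le hp hδ0 hδ1 hδl hadm).trans (add_le_add le_rfl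
            (error_le_weightScale hr (Nat.sub_le _ _) hl3 hnδ hδ0))
      _ = (δ + (1 - δ)⁻¹ * greedyConst + δ) * weightScale (n - i) := by ring
      _ ≤ (1 + ε) * greedyConst * weightScale (n - i) := by gcongr
      _ = _ := by rw [weightScale, hcast]
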